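/- **Theorem 1 (Accuracy of the method).** Let $d\ge 0$, $\epsilon_F\in\mathbb R$, $e_g>0$ and $v\ge 0$. There are constants $C,\gamma>0$, depending only on $d$, $\epsilon_F$, $e_g$ and $v$, with the following property. Let $V\in L^\infty(\mathbb R^d;\mathbb R)$ with $\|V\|_{L^\infty}\le v$, and let $H=-\tfrac12\Delta+V$ on $L^2(\mathbb R^d)$ with domain $H^2(\mathbb R^d)$. Let $\Lambda\subset\Lambda_b\subset\mathbb R^d$ with $\Lambda_b$ open (the subdomain and the buffer region), and let $H_{\Lambda_b}$ be any restriction of $H$ to $\Lambda_b$, that is, any self-adjoint operator in $L^2(\Lambda_b)$ such that every $u$ in its domain satisfies $\Delta u\in L^2(\Lambda_b)$ in the sense of distributions and $H_{\Lambda_b}u=-\tfrac12\Delta u+Vu$. Assume the gap assumption: the spectrum of $H$ at or below $\epsilon_F$ (the occupied spectrum) lies in $(-\infty,\epsilon_F-e_g/2]$, the spectrum of $H$ above $\epsilon_F$ (the unoccupied spectrum) lies in $[\epsilon_F+e_g/2,\infty)$, and $(\epsilon_F-e_g/2,\epsilon_F+e_g/2)\cap\operatorname{spec}(H_{\Lambda_b})=\emptyset$.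 Let $\mathscr C$ be a closed piecewise $C^1$ curve in $\mathbb C$ that avoids both spectra and has winding number $1$ around every point of the spectrum of $H$ or of $H_{\Lambda_b}$ that is at most $\epsilon_F$, and winding number $0$ around every point of these spectra above $\epsilon_F$. For each $x$ let $\varphi_x\in L^2(\mathbb R^d)$ be a given function (the mollifier at $x$), and define the mollified densities $$\rho(x)=\frac1{2\pi i}\int_{\mathscr C}\bigl\langle\varphi_x,(\lambda-H)^{-1}\varphi_x\bigr\rangle\,d\lambda,\qquad \rho_\Lambda(x)=\frac1{2\pi i}\int_{\mathscr C}\bigl\langle\varphi_x|_{\Lambda_b},(\lambda-H_{\Lambda_b})^{-1}\varphi_x|_{\Lambda_b}\bigr\rangle\,d\lambda .$$ Then, for all $x\in\Lambda$, $$|\rho(x)-\rho_\Lambda(x)|\le C\,\|\varphi_x\|_{L^2}^2\,e^{-2\gamma(\operatorname{dist}(\operatorname{supp}\varphi_x,\Lambda_b^c)-1)},$$ where $\operatorname{dist}(A,B)=\inf_{a\in A,\,b\in B}|a-b|$; if this distance is infinite because one of the sets is empty, the right-hand side is read as $0$. -/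

import Mathlib

open MeasureTheory
open scoped ENNReal NNReal ContDiff Laplacian SchwartzMap

noncomputable section

namespace DivideAndConquer

/-! ### Unbounded operators: resolvent and spectrum -/

section Resolvent

variable {𝓗 : Type*} [NormedAddCommGroup 𝓗] [InnerProductSpace ℂ 𝓗]

/-- The bounded operator `R` is a two-sided inverse of `z - A : D(A) → 𝓗`. -/
structure IsResolventAt (A : 𝓗 →ₗ.[ℂ] 𝓗) (z : ℂ) (R : 𝓗 →L[ℂ] 𝓗) : Prop where
  right_inv : ∀ f : 𝓗, ∃ u : A.domain, (u : 𝓗) = R f ∧ z • (u : 𝓗) - A u = f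
  left_inv : ∀ u : A.domain, R (z • (u : 𝓗) - A u) = u

theorem IsResolventAt.unique {A : 𝓗 →ₗ.[ℂ] 𝓗} {z : ℂ} {R S : 𝓗 →L[ℂ] 𝓗}
    (hR : IsResolventAt A z R) (hS : IsResolventAt A z S) : R = S := by
  ext f
  obtain ⟨u, hu, huf⟩ := hR.right_inv f
  have h := hS.left_inv u
  rw [huf] at h
  rw [h, hu]

/-- The set of `z` such that `z - A` has a bounded inverse. -/
def resolventSet (A : 𝓗 →ₗ.[ℂ] 𝓗) : Set ℂ := {z | ∃ R, IsResolventAt A z R}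

/-- The spectrum of a (possibly unbounded) operator. -/
def spec (A : 𝓗 →ₗ.[ℂ] 𝓗) : Set ℂ := (resolventSet A)ᶜ

open Classical in
/-- The resolvent `(z - A)⁻¹`, with the value `0` on the spectrum. -/
def resolvent (A : 𝓗 →ₗ.[ℂ] 𝓗) (z : ℂ) : 𝓗 →L[ℂ] 𝓗 :=
  if h : ∃ R, IsResolventAt A z R then h.choose else 0

theorem isResolventAt_resolvent {A : 𝓗 →ₗ.[ℂ] 𝓗} {z : ℂ} (hz : z ∈ resolventSet A) :
    IsResolventAt A z (resolvent A z) := by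
  have h : ∃ R, IsResolventAt A z R := hz
  rw [resolvent, dif_pos h]
  exact h.choose_spec

/-- The part of the spectrum at or below the Fermi level. -/
def occupiedSpec (A : 𝓗 →ₗ.[ℂ] 𝓗) (εF : ℝ) : Set ℝ := {t | (t : ℂ) ∈ spec A ∧ t ≤ εF}

/-- The part of the spectrum above the Fermi level. -/
def unoccupiedSpec (A : 𝓗 →ₗ.[ℂ] 𝓗) (εF : ℝ) : Set ℝ := {t | (t : ℂ) ∈ spec A ∧ εF < t}

end Resolvent

/-- The gap assumption for a system `A` and a subsystem `B`. -/
structure GapAssumption {𝓗 𝓚 : Type*} [NormedAddCommGroup 𝓗] [InnerProductSpace ℂ 𝓗]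
    [NormedAddCommGroup 𝓚] [InnerProductSpace ℂ 𝓚]
    (A : 𝓗 →ₗ.[ℂ] 𝓗) (B : 𝓚 →ₗ.[ℂ] 𝓚) (εF eg : ℝ) : Prop where
  occupied_le : ∀ t ∈ occupiedSpec A εF, t ≤ εF - eg / 2
  le_unoccupied : ∀ t ∈ unoccupiedSpec A εF, εF + eg / 2 ≤ t
  subsystem_gap : ∀ t ∈ Set.Ioo (εF - eg / 2) (εF + eg / 2), (t : ℂ) ∉ spec B

/-! ### Contours -/

/-- A closed, continuous, piecewise continuously differentiable curve in `ℂ`, parametrized by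
`[0, 1]`: off finitely many points the derivative exists, is continuous, and is bounded. -/
structure IsContour (c : ℝ → ℂ) : Prop where
  continuousOn : ContinuousOn c (Set.Icc 0 1)
  closed : c 0 = c 1
  piecewise : ∃ s : Finset ℝ,
    (∀ t ∈ Set.Ioo (0 : ℝ) 1 \ ↑s, DifferentiableAt ℝ c t) ∧
    ContinuousOn (deriv c) (Set.Ioo (0 : ℝ) 1 \ ↑s) ∧
    ∃ K : ℝ, ∀ t ∈ Set.Ioo (0 : ℝ) 1 \ ↑s, ‖deriv c t‖ ≤ K

/-- The contour integral `∫_c f(z) dz`. -/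
def contourIntegral (c : ℝ → ℂ) (f : ℂ → ℂ) : ℂ := ∫ t in (0 : ℝ)..1, f (c t) * deriv c t

/-- The winding number of a contour around `z`. -/
def windingNumber (c : ℝ → ℂ) (z : ℂ) : ℂ :=
  (2 * Real.pi * Complex.I)⁻¹ * contourIntegral c (fun w ↦ (w - z)⁻¹)

/-- The contour `c` avoids the spectrum of `A`, encircles the occupied spectrum once
counterclockwise and does not encircle the unoccupied spectrum. -/
structure Separates {𝓗 : Type*} [NormedAddCommGroup 𝓗] [InnerProductSpace ℂ 𝓗]
    (c : ℝ → ℂ) (A : 𝓗 →ₗ.[ℂ] 𝓗) (εF : ℝ) : Prop where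
  avoids : ∀ t ∈ Set.Icc (0 : ℝ) 1, c t ∉ spec A
  occupied : ∀ t ∈ occupiedSpec A εF, windingNumber c t = 1
  unoccupied : ∀ t ∈ unoccupiedSpec A εF, windingNumber c t = 0

/-- The density of `A` mollified by `f`, that is `(2πi)⁻¹ ∫_c ⟨f, (z - A)⁻¹ f⟩ dz`. -/
def mollifiedDensity {𝓗 : Type*} [NormedAddCommGroup 𝓗] [InnerProductSpace ℂ 𝓗]
    (A : 𝓗 →ₗ.[ℂ] 𝓗) (c : ℝ → ℂ) (f : 𝓗) : ℂ :=
  (2 * Real.pi * Complex.I)⁻¹ * contourIntegral c (fun z ↦ inner ℂ f (resolvent A z f))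

/-! ### Schrödinger operators -/

/-- The Euclidean space `ℝᵈ`. -/
abbrev Space (d : ℕ) : Type := EuclideanSpace ℝ (Fin d)

section Schrodinger

variable {d : ℕ}

/-- Smooth real-valued functions with compact support in `U`. -/
structure IsTestFunction (U : Set (Space d)) (ψ : Space d → ℝ) : Prop where
  smooth : ContDiff ℝ ∞ ψ
  compact : HasCompactSupport ψ
  subset : tsupport ψ ⊆ U

/-- `l` is the Laplacian of `u` on `U` in the sense of distributions.  Here `μ` is Lebesgue measure
on `U`. -/
def IsWeakLaplacian (U : Set (Space d)) (μ : Measure (Space d)) (u l : Lp ℂ 2 μ) : Prop :=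
  ∀ ψ : Space d → ℝ, IsTestFunction U ψ → ∫ y, (Δ ψ) y • u y ∂μ = ∫ y, ψ y • l y ∂μ

theorem two_le : (2 : WithTop ℕ∞) ≤ ((⊤ : ℕ∞) : WithTop ℕ∞) :=
  WithTop.coe_le_coe.mpr (le_top : (2 : ℕ∞) ≤ ⊤)

theorem IsTestFunction.continuous_laplacian {U : Set (Space d)} {ψ : Space d → ℝ}
    (h : IsTestFunction U ψ) : Continuous (Δ ψ) := by
  rw [InnerProductSpace.laplacian_eq_iteratedFDeriv_stdOrthonormalBasis]
  refine continuous_finsetSum _ fun i _ ↦ ?_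
  exact (ContinuousMultilinearMap.apply ℝ (fun _ : Fin 2 ↦ Space d) ℝ _).continuous.comp
    (h.smooth.continuous_iteratedFDeriv two_le)

theorem IsTestFunction.compact_laplacian {U : Set (Space d)} {ψ : Space d → ℝ}
    (h : IsTestFunction U ψ) : HasCompactSupport (Δ ψ) := by
  refine (h.compact.iteratedFDeriv (𝕜 := ℝ) 2).mono fun y hy ↦ ?_
  contrapose! hy
  rw [Function.notMem_support] at hy ⊢
  rw [InnerProductSpace.laplacian_eq_iteratedFDeriv_stdOrthonormalBasis]
  simp [hy]

theorem integrable_smul_lp {μ : Measure (Space d)} [IsFiniteMeasureOnCompacts μ]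
    {χ : Space d → ℝ} (hc : Continuous χ) (hs : HasCompactSupport χ) (u : Lp ℂ 2 μ) :
    Integrable (fun y ↦ χ y • u y) μ :=
  memLp_one_iff_integrable.mp
    (MemLp.smul (p := 2) (q := 2) (r := 1) (Lp.memLp u) (hc.memLp_of_hasCompactSupport hs))

theorem IsWeakLaplacian.zero (U : Set (Space d)) (μ : Measure (Space d)) :
    IsWeakLaplacian U μ 0 0 := by
  intro ψ _
  have h : ∀ χ : Space d → ℝ, ∫ y, χ y • (0 : Lp ℂ 2 μ) y ∂μ = 0 := fun χ ↦ by
    rw [integral_congr_ae (g := fun _ ↦ (0 : ℂ)), integral_zero]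
    filter_upwards [Lp.coeFn_zero ℂ 2 μ] with y hy
    rw [hy, Pi.zero_apply, smul_zero]
  rw [h, h]

theorem IsWeakLaplacian.add {U : Set (Space d)} {μ : Measure (Space d)}
    [IsFiniteMeasureOnCompacts μ] {u₁ u₂ l₁ l₂ : Lp ℂ 2 μ} (h₁ : IsWeakLaplacian U μ u₁ l₁)
    (h₂ : IsWeakLaplacian U μ u₂ l₂) : IsWeakLaplacian U μ (u₁ + u₂) (l₁ + l₂) := by
  intro ψ hψ
  have h : ∀ χ : Space d → ℝ, Continuous χ → HasCompactSupport χ → ∀ a b : Lp ℂ 2 μ,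
      ∫ y, χ y • (a + b) y ∂μ = ∫ y, χ y • a y ∂μ + ∫ y, χ y • b y ∂μ := by
    intro χ hc hs a b
    rw [← integral_add (integrable_smul_lp hc hs a) (integrable_smul_lp hc hs b)]
    refine integral_congr_ae ?_
    filter_upwards [Lp.coeFn_add a b] with y hy
    rw [hy, Pi.add_apply, smul_add]
  rw [h _ hψ.continuous_laplacian hψ.compact_laplacian,
    h _ hψ.smooth.continuous hψ.compact, h₁ ψ hψ, h₂ ψ hψ]

theorem IsWeakLaplacian.smul {U : Set (Space d)} {μ : Measure (Space d)} (k : ℂ)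
    {u l : Lp ℂ 2 μ} (h : IsWeakLaplacian U μ u l) : IsWeakLaplacian U μ (k • u) (k • l) := by
  intro ψ hψ
  have h' : ∀ (χ : Space d → ℝ) (a : Lp ℂ 2 μ),
      ∫ y, χ y • (k • a) y ∂μ = k * ∫ y, χ y • a y ∂μ := by
    intro χ a
    rw [← integral_const_mul]
    refine integral_congr_ae ?_
    filter_upwards [Lp.coeFn_smul k a] with y hy
    simp [hy, mul_left_comm]
  rw [h', h', h ψ hψ]

theorem IsWeakLaplacian.eq_zero {U : Set (Space d)} (hU : IsOpen U)
    {l : Lp ℂ 2 (volume.restrict U)} (h : IsWeakLaplacian U (volume.restrict U) 0 l) : l = 0 := by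
  rw [Lp.eq_zero_iff_ae_eq_zero]
  have key : ∀ᵐ y ∂(volume.restrict U), y ∈ U → l y = 0 := by
    refine hU.ae_eq_zero_of_integral_contDiff_smul_eq_zero ?_ fun ψ h₁ h₂ h₃ ↦ ?_
    · exact ((Lp.memLp l).locallyIntegrable (by norm_num)).locallyIntegrableOn U
    · rw [← h ψ ⟨h₁, h₂, h₃⟩, integral_congr_ae (g := fun _ ↦ (0 : ℂ)), integral_zero]
      filter_upwards [Lp.coeFn_zero ℂ 2 (volume.restrict U)] with y hy
      rw [hy, Pi.zero_apply, smul_zero]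
  filter_upwards [key, ae_restrict_mem hU.measurableSet] with y h₁ h₂
  exact h₁ h₂

/-- The graph of the maximal realization of `-½Δ + V` on `U`: the pairs `(u, g)` of functions in
`L²(U)` with `Δu ∈ L²(U)` and `g = -½Δu + Vu`. -/
def maxGraph (V : Space d → ℝ) (U : Set (Space d)) (μ : Measure (Space d))
    [IsFiniteMeasureOnCompacts μ] : Submodule ℂ (Lp ℂ 2 μ × Lp ℂ 2 μ) where
  carrier := {p | ∃ l : Lp ℂ 2 μ, IsWeakLaplacian U μ p.1 l ∧
    p.2 =ᵐ[μ] fun y ↦ -(1 / 2 : ℂ) * l y + V y * p.1 y}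
  zero_mem' := by
    refine ⟨0, IsWeakLaplacian.zero U μ, ?_⟩
    filter_upwards [Lp.coeFn_zero ℂ 2 μ] with y hy
    simp only [Prod.fst_zero, Prod.snd_zero, hy, Pi.zero_apply, mul_zero, add_zero]
  add_mem' := by
    rintro ⟨u, g⟩ ⟨u', g'⟩ ⟨l, hl, hg⟩ ⟨l', hl', hg'⟩
    refine ⟨l + l', hl.add hl', ?_⟩
    filter_upwards [Lp.coeFn_add g g', Lp.coeFn_add u u', Lp.coeFn_add l l', hg, hg']
      with y h₁ h₂ h₃ h₄ h₅
    simp only [Prod.mk_add_mk, h₁, h₂, h₃, Pi.add_apply, h₄, h₅]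
    ring
  smul_mem' := by
    rintro k ⟨u, g⟩ ⟨l, hl, hg⟩
    refine ⟨k • l, hl.smul k, ?_⟩
    filter_upwards [Lp.coeFn_smul k g, Lp.coeFn_smul k u, Lp.coeFn_smul k l, hg]
      with y h₁ h₂ h₃ h₄
    simp only [Prod.smul_mk, h₁, h₂, h₃, Pi.smul_apply, h₄, smul_eq_mul]
    ring

/-- The maximal realization of `-½Δ + V` in `L²(U)`. -/
def maxOp (V : Space d → ℝ) (U : Set (Space d)) (μ : Measure (Space d))
    [IsFiniteMeasureOnCompacts μ] : Lp ℂ 2 μ →ₗ.[ℂ] Lp ℂ 2 μ :=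
  (maxGraph V U μ).toLinearPMap

theorem graph_maxOp (V : Space d → ℝ) {U : Set (Space d)} (hU : IsOpen U) :
    (maxOp V U (volume.restrict U)).graph = maxGraph V U (volume.restrict U) := by
  refine Submodule.toLinearPMap_graph_eq _ ?_
  rintro ⟨u, g⟩ ⟨l, hl, hg⟩ hu
  obtain rfl : u = 0 := hu
  obtain rfl := hl.eq_zero hU
  rw [Lp.eq_zero_iff_ae_eq_zero]
  filter_upwards [hg, Lp.coeFn_zero ℂ 2 (volume.restrict U)] with y h₁ h₂
  simp only [h₁, h₂, Pi.zero_apply, mul_zero, add_zero]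

theorem graph_maxOp_univ (V : Space d → ℝ) :
    (maxOp V Set.univ volume).graph = maxGraph V Set.univ volume := by
  have key : ∀ (μ : Measure (Space d)) [IsFiniteMeasureOnCompacts μ],
      μ = volume.restrict Set.univ → (maxOp V Set.univ μ).graph = maxGraph V Set.univ μ := by
    intro μ _ h
    subst h
    exact graph_maxOp V isOpen_univ
  exact key volume Measure.restrict_univ.symm

/-- The Sobolev space `H²(ℝᵈ)` as a subspace of `L²(ℝᵈ)`. -/
def sobolevTwo (d : ℕ) : Submodule ℂ (Lp ℂ 2 (volume : Measure (Space d))) where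
  carrier := {u | TemperedDistribution.MemSobolev 2 2 (u : 𝓢'(Space d, ℂ))}
  zero_mem' := by
    simp [← Lp.toTemperedDistributionCLM_apply]
  add_mem' := by
    intro u w hu hw
    simpa [← Lp.toTemperedDistributionCLM_apply] using hu.add hw
  smul_mem' := by
    intro k u hu
    simpa [← Lp.toTemperedDistributionCLM_apply] using hu.smul k

/-- The Hamiltonian `H = -½Δ + V` on `L²(ℝᵈ)` with domain `H²(ℝᵈ)`. -/
def hamiltonian (V : Space d → ℝ) :
    Lp ℂ 2 (volume : Measure (Space d)) →ₗ.[ℂ] Lp ℂ 2 (volume : Measure (Space d)) :=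
  (maxOp V Set.univ volume).domRestrict (sobolevTwo d)

theorem exists_isWeakLaplacian {u : Lp ℂ 2 (volume : Measure (Space d))}
    (hu : u ∈ sobolevTwo d) : ∃ l, IsWeakLaplacian Set.univ volume u l := by
  have h : TemperedDistribution.MemSobolev (2 - 2) 2 (Δ (u : 𝓢'(Space d, ℂ))) :=
    TemperedDistribution.MemSobolev.laplacian hu
  rw [sub_self, TemperedDistribution.memSobolev_zero_iff] at h
  obtain ⟨l, hl⟩ := h
  refine ⟨l, fun ψ hψ ↦ ?_⟩
  have hs : HasCompactSupport (Complex.ofRealCLM ∘ ψ) := hψ.compact.comp_left rfl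
  have hc : ContDiff ℝ ∞ (Complex.ofRealCLM ∘ ψ) := Complex.ofRealCLM.contDiff.comp hψ.smooth
  have h := congrArg (fun T : 𝓢'(Space d, ℂ) ↦ T (hs.toSchwartzMap hc)) hl
  simp only [TemperedDistribution.laplacian_apply_apply, Lp.toTemperedDistribution_apply,
    SchwartzMap.laplacian_apply] at h
  have e : ∀ y, Δ (Complex.ofRealCLM ∘ ψ) y = (Δ ψ y : ℂ) := fun y ↦
    (hψ.smooth.contDiffAt.of_le two_le).laplacian_CLM_comp_left
  have e₀ : ∀ y, hs.toSchwartzMap hc y = (ψ y : ℂ) := fun y ↦ rfl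
  have e₁ : (hs.toSchwartzMap hc : Space d → ℂ) = Complex.ofRealCLM ∘ ψ := rfl
  simp only [e₀, e₁, e] at h
  simpa only [Complex.real_smul, smul_eq_mul] using h

/-- The domain of `H` is `H²(ℝᵈ)`. -/
theorem hamiltonian_domain {V : Space d → ℝ} (hV : MemLp V ∞ volume) :
    (hamiltonian V).domain = sobolevTwo d := by
  refine inf_eq_left.mpr fun u hu ↦ ?_
  obtain ⟨l, hl⟩ := exists_isWeakLaplacian hu
  have hVu : MemLp (fun y ↦ (V y : ℂ) * u y) 2 volume :=
    MemLp.mul' (p := ∞) (q := 2) (Lp.memLp u) hV.ofReal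
  have hg : MemLp (fun y ↦ -(1 / 2 : ℂ) * l y + V y * u y) 2 volume :=
    ((Lp.memLp l).const_mul _).add hVu
  exact ⟨(u, hg.toLp _), ⟨l, hl, hg.coeFn_toLp⟩, rfl⟩

/-- `HU` is a restriction of `-½Δ + V` to `U`: a self-adjoint operator in `L²(U)` which acts as
`-½Δ + V` in the sense of distributions on its domain.  Every choice of boundary conditions
that makes the operator self-adjoint is allowed. -/
structure IsRestriction (V : Space d → ℝ) (U : Set (Space d))
    (HU : Lp ℂ 2 (volume.restrict U) →ₗ.[ℂ] Lp ℂ 2 (volume.restrict U)) : Prop where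
  selfAdjoint : IsSelfAdjoint HU
  le_maxOp : HU ≤ maxOp V U (volume.restrict U)

/-- The restriction map `L²(ℝᵈ) → L²(U)`. -/
def restrictTo (U : Set (Space d)) (f : Lp ℂ 2 (volume : Measure (Space d))) :
    Lp ℂ 2 (volume.restrict U) :=
  LpToLpRestrictCLM (Space d) ℂ ℂ volume 2 U f

end Schrodinger

/-- The distance between two sets, with value `∞` if one of them is empty. -/
def setDist {X : Type*} [PseudoEMetricSpace X] (A B : Set X) : ℝ≥0∞ :=
  ⨅ y ∈ A, ⨅ z ∈ B, edist y z

end DivideAndConquer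

end

/-!
The mollified density is the expectation `⟨φ, P φ⟩` of the spectral projection `P` on the occupied
states, so the contour may be replaced by any other one that separates the occupied from the
unoccupied spectrum. Both operators have a gap of half-width `a = eg / 2` around `εF`, and the
natural choice is the vertical line `z = εF + i t`: there the resolvents are bounded by
`(a² + t²)^(-1/2)`, uniformly in the operator. The given contour carries no quantitative information
and is not used in any estimate.

To avoid the spectral theorem for unbounded operators, everything is expressed through the bounded
self-adjoint operator `T = (εF - A)⁻¹` and its continuous functional calculus: the resolvent
`(z - A)⁻¹` has the symbol `s / (1 + (z - εF) s)`, and the contour integral has as symbol the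
indicator function of `s > 0` (`IsGapped.exists_mollifiedDensity_eq`), which is continuous on the
spectrum of `T` even at `0`, because it is a uniformly convergent integral of continuous symbols. The
principal value of the line integral gives the same operator minus `1 / 2`
(`IsGapped.tendsto_integral_line`). Hence a bound of order `(a² + t²)⁻¹` for the difference of
`⟨φ, (z - H)⁻¹ φ⟩` and `⟨φ, (z - H_Λb)⁻¹ φ⟩` on the line bounds the difference of the densities
(`norm_mollifiedDensity_sub_le`).

That bound comes from an exponential decay estimate of Caccioppoli type. For `u = (z - H)⁻¹ φ` and a
cutoff `χ` that vanishes near the support `S` of `φ` one has `(z - H)(χ u) = ∇χ · ∇u + ½ (Δχ) u`,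
which lives in a shell of width one; the energy estimate `IsTest.energy_le` then bounds the `H¹` energy
beyond the shell by a multiple of the energy in the shell (`IsTest.tailEnergy_step`), so that the
energy at distance `n` from `S` decays like a power `qⁿ` with `q < 1` (`IsTest.tailEnergy_le`). In the
other direction, `(1 - χ) u` has compact support in `Λb` if `χ = 1` near the complement of `Λb`, and
therefore belongs to the domain of every self-adjoint restriction `H_Λb`
(`IsRestriction.mem_graph`). It solves the equation in `Λb` up to the same commutator, which is
exponentially small (`IsRestriction.norm_inner_sub_le`). The boundary conditions play no role.

The cutoff arguments are carried out for smooth functions `u` with compact support; these form a core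
of `H` (`exists_isTest_near`), and the final estimate is obtained by passing to the limit
(`IsRestriction.norm_inner_resolvent_sub_le`).
-/

noncomputable section

namespace DivideAndConquer

/-! ### Resolvents as functions of one bounded self-adjoint operator -/

section Spectral

variable {𝓗 : Type*} [NormedAddCommGroup 𝓗] [InnerProductSpace ℂ 𝓗]
variable {A : 𝓗 →ₗ.[ℂ] 𝓗}

/-- A bounded inverse of `1 + (w - z)(z - A)⁻¹` carries the resolvent from `z` to `w`. -/
theorem IsResolventAt.mul_of_inverse {z w : ℂ} {R S : 𝓗 →L[ℂ] 𝓗} (hR : IsResolventAt A z R)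
    (h₁ : (1 + (w - z) • R) * S = 1) (h₂ : S * (1 + (w - z) • R) = 1) :
    IsResolventAt A w (R * S) where
  right_inv f := by
    obtain ⟨u, hu, huf⟩ := hR.right_inv (S f)
    refine ⟨u, hu, ?_⟩
    have h := congrArg (fun B : 𝓗 →L[ℂ] 𝓗 ↦ B f) h₁
    simp only [mul_apply_eq_comp, add_apply,
      one_apply_eq_self, smul_apply] at h
    rw [← hu, ← huf] at h
    rw [← h, sub_smul]
    abel
  left_inv u := by
    have h := congrArg (fun B : 𝓗 →L[ℂ] 𝓗 ↦ B (z • (u : 𝓗) - A u)) h₂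
    simp only [mul_apply_eq_comp, add_apply,
      one_apply_eq_self, smul_apply, hR.left_inv u] at h
    have e : w • (u : 𝓗) - A u = z • (u : 𝓗) - A u + (w - z) • (u : 𝓗) := by
      rw [sub_smul]; abel
    rw [mul_apply_eq_comp, e, h, hR.left_inv u]

/-- The resolvent identity. -/
theorem IsResolventAt.mul_eq {z w : ℂ} {R S : 𝓗 →L[ℂ] 𝓗} (hR : IsResolventAt A z R)
    (hS : IsResolventAt A w S) : (1 + (w - z) • R) * S = R := by
  ext f
  obtain ⟨u, hu, huf⟩ := hS.right_inv f
  have h := hR.left_inv u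
  have e : z • (u : 𝓗) - A u = f - (w - z) • (u : 𝓗) := by
    rw [← huf, sub_smul]; abel
  rw [e, map_sub, map_smul, sub_eq_iff_eq_add] at h
  simp only [mul_apply_eq_comp, add_apply,
    one_apply_eq_self, smul_apply, ← hu, h]

theorem IsResolventAt.isUnit {z w : ℂ} {R S : 𝓗 →L[ℂ] 𝓗} (hR : IsResolventAt A z R)
    (hS : IsResolventAt A w S) : IsUnit (1 + (w - z) • R) := by
  have e₁ := hR.mul_eq hS
  have e₂ := hS.mul_eq hR
  refine ⟨⟨1 + (w - z) • R, 1 - (w - z) • S, ?_, ?_⟩, rfl⟩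
  · rw [mul_sub, mul_one, mul_smul_comm, e₁, add_sub_cancel_right]
  · have e₃ : (1 : 𝓗 →L[ℂ] 𝓗) - (w - z) • S = 1 + (z - w) • S := by
      rw [← neg_sub w z, neg_smul, sub_eq_add_neg]
    rw [e₃, mul_add, mul_one, mul_smul_comm, e₂, ← neg_sub w z, neg_smul, neg_add_cancel_right]

/-- A nonzero point `s` of the spectrum of `(z - A)⁻¹` comes from the point `z - s⁻¹` of the
spectrum of `A`. -/
theorem sub_inv_mem_spec {z s : ℂ} {R : 𝓗 →L[ℂ] 𝓗} (hR : IsResolventAt A z R)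
    (hs : s ∈ spectrum ℂ R) (h₀ : s ≠ 0) : z - s⁻¹ ∈ spec A := by
  rintro ⟨S, hS⟩
  refine hs ?_
  have h := hR.isUnit hS
  have e : algebraMap ℂ (𝓗 →L[ℂ] 𝓗) s - R = s • (1 + (z - s⁻¹ - z) • R) := by
    rw [Algebra.algebraMap_eq_smul_one, smul_add, smul_smul]
    have : s * (z - s⁻¹ - z) = -1 := by field_simp; ring
    rw [this, neg_smul, one_smul, sub_eq_add_neg]
  change IsUnit (algebraMap ℂ (𝓗 →L[ℂ] 𝓗) s - R)
  rw [e]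
  exact h.smul (Units.mk0 s h₀)

/-- At resolvent points `w` the denominator of the symbol of `(w - A)⁻¹` does not vanish on the
spectrum of `R = (z - A)⁻¹`. -/
theorem one_add_mul_ne_zero {z w s : ℂ} {R : 𝓗 →L[ℂ] 𝓗} (hR : IsResolventAt A z R)
    (hw : w ∈ resolventSet A) (hs : s ∈ spectrum ℂ R) : 1 + (w - z) * s ≠ 0 := by
  intro h
  have h₀ : s ≠ 0 := by rintro rfl; simp at h
  have e : z - s⁻¹ = w := by field_simp; linear_combination -h
  exact (e ▸ sub_inv_mem_spec hR hs h₀) hw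

theorem resolvent_mul_eq {z w : ℂ} (hz : z ∈ resolventSet A) (hw : w ∈ resolventSet A) :
    resolvent A w * (1 + (w - z) • resolvent A z) = resolvent A z := by
  have h₁ := (isResolventAt_resolvent hw).mul_eq (isResolventAt_resolvent hz)
  have h₂ := (isResolventAt_resolvent hz).mul_eq (isResolventAt_resolvent hw)
  rw [add_mul, one_mul, smul_mul_assoc] at h₁
  rw [mul_add, mul_one, mul_smul_comm]
  nth_rw 1 [← h₁]
  rw [← neg_sub w z, neg_smul, neg_add_cancel_right]

/-- The functions `s ↦ s / (1 + (z - εF) s)` that represent the resolvents `(z - A)⁻¹` along a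
path `z = ζ t`, in terms of the resolvent `(εF - A)⁻¹`. -/
theorem exists_symbol (A : 𝓗 →ₗ.[ℂ] 𝓗) {εF : ℝ} {ζ : ℝ → ℂ} (hζ : Continuous ζ)
    (hne : ∀ t, ∀ s ∈ spectrum ℂ (resolvent A εF), 1 + (ζ t - εF) * s ≠ 0) :
    ∃ F : C(ℝ, C(spectrum ℂ (resolvent A εF), ℂ)),
      ∀ t s, F t s = (s : ℂ) / (1 + (ζ t - εF) * s) := by
  let G : C(ℝ × spectrum ℂ (resolvent A εF), ℂ) :=
    ⟨fun p ↦ (p.2 : ℂ) / (1 + (ζ p.1 - εF) * p.2),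
      Continuous.div (by fun_prop) (by fun_prop) fun p ↦ hne p.1 p.2 p.2.2⟩
  exact ⟨G.curry, fun t s ↦ rfl⟩

theorem symbol_mul {εF : ℝ} {z : ℂ} {F : C(spectrum ℂ (resolvent A εF), ℂ)}
    (hne : ∀ s ∈ spectrum ℂ (resolvent A εF), 1 + (z - εF) * s ≠ 0)
    (hF : ∀ s, F s = (s : ℂ) / (1 + (z - εF) * s)) :
    F * (1 + (z - εF) • (ContinuousMap.restrict (spectrum ℂ (resolvent A εF)) (.id ℂ))) =
      ContinuousMap.restrict (spectrum ℂ (resolvent A εF)) (.id ℂ) := by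
  ext s
  have := hne s s.2
  simpa [hF] using div_mul_cancel₀ _ this

/-- A densely defined symmetric operator without spectrum in `(εF - a, εF + a)`.  Self-adjointness
is not part of the definition: it follows from symmetry, since the real point `εF` lies in the
resolvent set. -/
structure IsGapped (A : 𝓗 →ₗ.[ℂ] 𝓗) (εF a : ℝ) : Prop where
  pos : 0 < a
  symm : A.IsFormalAdjoint A
  dense : Dense (A.domain : Set 𝓗)
  gap : ∀ t ∈ Set.Ioo (εF - a) (εF + a), (t : ℂ) ∉ spec A

namespace IsGapped

variable {εF a : ℝ} (h : IsGapped A εF a)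

include h

theorem mem_resolventSet : (εF : ℂ) ∈ resolventSet A := by
  have := h.gap εF ⟨by linarith [h.pos], by linarith [h.pos]⟩
  rwa [spec, Set.notMem_compl_iff] at this

theorem isResolventAt : IsResolventAt A εF (resolvent A εF) :=
  isResolventAt_resolvent h.mem_resolventSet

variable [CompleteSpace 𝓗]

theorem isSelfAdjoint : IsSelfAdjoint (resolvent A εF) := by
  rw [ContinuousLinearMap.isSelfAdjoint_iff_isSymmetric]
  intro f g
  obtain ⟨u, hu, huf⟩ := h.isResolventAt.right_inv f
  obtain ⟨w, hw, hwg⟩ := h.isResolventAt.right_inv g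
  simp only [ContinuousLinearMap.coe_coe]
  rw [← hu, ← hw, ← huf, ← hwg, inner_sub_left, inner_sub_right, inner_smul_left,
    inner_smul_right, h.symm u w, Complex.conj_ofReal]

theorem spectrum_real {s : ℂ} (hs : s ∈ spectrum ℂ (resolvent A εF)) : s = (s.re : ℂ) :=
  h.isSelfAdjoint.mem_spectrum_eq_re hs

theorem mem_spec_of_ne_zero {s : ℂ} (hs : s ∈ spectrum ℂ (resolvent A εF)) (h₀ : s ≠ 0) :
    ((εF - s.re⁻¹ : ℝ) : ℂ) ∈ spec A := by
  have := sub_inv_mem_spec h.isResolventAt hs h₀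
  rw [h.spectrum_real hs] at this
  simpa using this

/-- The gap bounds the spectrum of `(εF - A)⁻¹`, whose nonzero points are `(εF - λ)⁻¹` with `λ` in
the spectrum of `A`. -/
theorem norm_le_of_mem_spectrum {s : ℂ} (hs : s ∈ spectrum ℂ (resolvent A εF)) :
    ‖s‖ ≤ a⁻¹ := by
  have ha := h.pos
  by_contra! hlt
  have h₀ : s ≠ 0 := by rintro rfl; rw [norm_zero] at hlt; have := inv_pos.mpr ha; linarith
  have hmem := h.mem_spec_of_ne_zero hs h₀
  have hr : ‖s‖ = |s.re| := by rw [h.spectrum_real hs]; simp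
  have h1 : |s.re⁻¹| < a := by
    rw [abs_inv, ← hr]
    exact inv_lt_of_inv_lt₀ ha hlt
  rw [abs_lt] at h1
  exact h.gap _ ⟨by linarith, by linarith⟩ hmem

/-- The operator norm of the self-adjoint operator `(εF - A)⁻¹` equals its spectral radius. -/
theorem norm_resolvent_le : ‖resolvent A εF‖ ≤ a⁻¹ := by
  have ha := inv_pos.mpr h.pos
  have h1 := h.isSelfAdjoint.spectralRadius_eq_nnnorm
  have h2 : spectralRadius ℂ (resolvent A εF) ≤ ENNReal.ofReal a⁻¹ := by
    refine iSup₂_le fun s hs ↦ ?_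
    rw [← ENNReal.ofReal_coe_nnreal, coe_nnnorm]
    exact ENNReal.ofReal_le_ofReal (h.norm_le_of_mem_spectrum hs)
  rw [h1, ← ENNReal.ofReal_coe_nnreal, coe_nnnorm] at h2
  exact (ENNReal.ofReal_le_ofReal_iff ha.le).mp h2

/-- The lower bound at `εF`, improved by `t²` because `εF - A` is symmetric: the cross term between
`(εF - A)u` and `itu` has real part zero. -/
theorem lower_bound (t : ℝ) (u : A.domain) :
    (a ^ 2 + t ^ 2) * ‖(u : 𝓗)‖ ^ 2 ≤ ‖((εF : ℂ) + t * Complex.I) • (u : 𝓗) - A u‖ ^ 2 := by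
  set g := (εF : ℂ) • (u : 𝓗) - A u with hg
  have hu : resolvent A εF g = u := h.isResolventAt.left_inv u
  have h1 : a * ‖(u : 𝓗)‖ ≤ ‖g‖ := by
    have := (resolvent A εF).le_opNorm g
    rw [hu] at this
    have h2 := mul_le_mul_of_nonneg_right h.norm_resolvent_le (norm_nonneg g)
    have ha := h.pos
    calc a * ‖(u : 𝓗)‖ ≤ a * (a⁻¹ * ‖g‖) := by gcongr; linarith
      _ = ‖g‖ := by field_simp
  have e : ((εF : ℂ) + t * Complex.I) • (u : 𝓗) - A u = g + (t * Complex.I) • (u : 𝓗) := by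
    rw [hg, add_smul]; abel
  have hre : (inner ℂ g ((t * Complex.I) • (u : 𝓗))).re = 0 := by
    have hs : (starRingEnd ℂ) (inner ℂ g (u : 𝓗)) = inner ℂ g (u : 𝓗) := by
      rw [inner_conj_symm, hg, inner_sub_left, inner_sub_right, inner_smul_left, inner_smul_right,
        h.symm u u, Complex.conj_ofReal]
    rw [inner_smul_right]
    have := Complex.conj_eq_iff_im.mp hs
    simp [this]
  have h3 := norm_add_sq (𝕜 := ℂ) g ((t * Complex.I) • (u : 𝓗))
  rw [RCLike.re_eq_complex_re, hre] at h3
  rw [e, h3, norm_smul]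
  have h4 : (a * ‖(u : 𝓗)‖) ^ 2 ≤ ‖g‖ ^ 2 := by
    have := h.pos
    gcongr
  simp only [norm_mul, Complex.norm_real, Complex.norm_I, mul_one, Real.norm_eq_abs, mul_pow,
    sq_abs] at h4 ⊢
  linarith

theorem cfcHom_one_add (z : ℂ) :
    cfcHom h.isSelfAdjoint.isStarNormal
      (1 + (z - εF) • (ContinuousMap.restrict (spectrum ℂ (resolvent A εF)) (.id ℂ))) =
      1 + (z - εF) • resolvent A εF := by
  rw [map_add, map_one, map_smul, cfcHom_id]

/-- Every resolvent is a continuous function of the resolvent at `εF`: with `s = (εF - λ)⁻¹`, the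
number `(z - λ)⁻¹` is `s / (1 + (z - εF)s)`. -/
theorem resolvent_eq_cfcHom {z : ℂ} (hz : z ∈ resolventSet A)
    {F : C(spectrum ℂ (resolvent A εF), ℂ)}
    (hF : ∀ s, F s = (s : ℂ) / (1 + (z - εF) * s)) :
    resolvent A z = cfcHom h.isSelfAdjoint.isStarNormal F := by
  have hne : ∀ s ∈ spectrum ℂ (resolvent A εF), 1 + (z - εF) * s ≠ 0 := fun s hs ↦
    one_add_mul_ne_zero h.isResolventAt hz hs
  have h₁ := congrArg (cfcHom h.isSelfAdjoint.isStarNormal) (symbol_mul hne hF)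
  rw [map_mul, h.cfcHom_one_add, cfcHom_id] at h₁
  refine (h.isResolventAt.isUnit (isResolventAt_resolvent hz)).mul_right_cancel ?_
  rw [h₁, resolvent_mul_eq h.mem_resolventSet hz]

theorem one_add_I_mul_ne_zero (t : ℝ) {s : ℂ} (hs : s ∈ spectrum ℂ (resolvent A εF)) :
    1 + ((εF : ℂ) + t * Complex.I - εF) * s ≠ 0 := by
  rw [h.spectrum_real hs]
  intro h0
  have := congrArg Complex.re h0
  simp at this

/-- The vertical line through the Fermi level avoids the spectrum, since the spectrum of
`(εF - A)⁻¹` is real. -/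
theorem line_mem_resolventSet (t : ℝ) : (εF : ℂ) + t * Complex.I ∈ resolventSet A := by
  have hne := fun s hs ↦ h.one_add_I_mul_ne_zero t (s := s) hs
  let K := C(spectrum ℂ (resolvent A εF), ℂ)
  let G : K := 1 + ((εF : ℂ) + t * Complex.I - εF) •
    (ContinuousMap.restrict (spectrum ℂ (resolvent A εF)) (.id ℂ))
  have hG : ∀ s, G s = 1 + ((εF : ℂ) + t * Complex.I - εF) * s := fun s ↦ rfl
  let I : K := ⟨fun s ↦ (G s)⁻¹, Continuous.inv₀ (by fun_prop) fun s ↦ by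
    rw [hG]; exact hne s s.2⟩
  have hGI : G * I = 1 := by
    ext s
    have : G s ≠ 0 := by rw [hG]; exact hne s s.2
    exact mul_inv_cancel₀ this
  refine ⟨_, h.isResolventAt.mul_of_inverse
    (S := cfcHom h.isSelfAdjoint.isStarNormal I) ?_ ?_⟩
  · rw [← h.cfcHom_one_add, ← map_mul]
    exact (congrArg _ hGI).trans (map_one _)
  · rw [← h.cfcHom_one_add, ← map_mul, mul_comm]
    exact (congrArg _ hGI).trans (map_one _)

theorem norm_resolvent_line_sq_le (t : ℝ) (f : 𝓗) :
    (a ^ 2 + t ^ 2) * ‖resolvent A (εF + t * Complex.I) f‖ ^ 2 ≤ ‖f‖ ^ 2 := by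
  obtain ⟨u, hu, huf⟩ := (isResolventAt_resolvent (h.line_mem_resolventSet t)).right_inv f
  have := h.lower_bound t u
  rwa [huf, hu] at this

end IsGapped

end Spectral

/-! ### Contour integrals of the resolvent -/

theorem IsContour.intervalIntegrable_deriv {c : ℝ → ℂ} (hc : IsContour c) :
    IntervalIntegrable (deriv c) volume 0 1 := by
  obtain ⟨s, -, -, K, hK⟩ := hc.piecewise
  rw [intervalIntegrable_iff_integrableOn_Ioo_of_le zero_le_one]
  refine IntegrableOn.of_bound (by simp) (measurable_deriv c).aestronglyMeasurable K ?_
  have hs : ∀ᵐ t ∂(volume : Measure ℝ), t ∉ (s : Set ℝ) := s.countable_toSet.ae_notMem _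
  filter_upwards [ae_restrict_mem measurableSet_Ioo, ae_restrict_of_ae hs] with t ht hts
  exact hK t ⟨ht, hts⟩

theorem arctan_le_self {y : ℝ} (hy : 0 ≤ y) : Real.arctan y ≤ y := by
  rcases hy.eq_or_lt with rfl | hy
  · simp
  · have := Real.lt_tan (Real.arctan_pos.mpr hy) (Real.arctan_lt_pi_div_two y)
    rw [Real.tan_arctan] at this
    exact this.le

/-- Truncating the line integral at `±N` replaces the sign function by `arctan`; after damping by a
factor `r` the error is uniformly small. -/
theorem abs_mul_half_sub_arctan_le {N r : ℝ} (hN : 0 < N) (hr : 0 < r) :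
    |r * (1 / 2 - Real.arctan (N * r) / Real.pi)| ≤ N⁻¹ := by
  have hpi := Real.pi_pos
  have h1 : Real.arctan (N * r)⁻¹ = Real.pi / 2 - Real.arctan (N * r) :=
    Real.arctan_inv_of_pos (by positivity)
  have h2 : r * (1 / 2 - Real.arctan (N * r) / Real.pi) = r * Real.arctan (N * r)⁻¹ / Real.pi := by
    rw [h1]; field_simp
  have h3 : 0 ≤ Real.arctan (N * r)⁻¹ := Real.arctan_nonneg.mpr (by positivity)
  rw [h2, abs_of_nonneg (by positivity), div_le_iff₀ hpi]
  calc r * Real.arctan (N * r)⁻¹ ≤ r * (N * r)⁻¹ := by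
        gcongr; exact arctan_le_self (by positivity)
    _ = N⁻¹ * 1 := by field_simp
    _ ≤ N⁻¹ * Real.pi := by gcongr; linarith [Real.pi_gt_three]

/-- The antiderivative is `arctan (tr) - (i/2) log (1 + t²r²)`, whose logarithmic part is even. -/
theorem integral_symbol_line (N r : ℝ) :
    ∫ t in -N..N, (r : ℂ) / (1 + (t * Complex.I) * r) = 2 * Real.arctan (N * r) := by
  have hd : ∀ t : ℝ, HasDerivAt
      (fun t : ℝ ↦ (Real.arctan (t * r) : ℂ) - Complex.I / 2 * (Real.log (1 + (t * r) ^ 2) : ℂ))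
      ((r : ℂ) / (1 + (t * Complex.I) * r)) t := by
    intro t
    have h0 : 1 + (t * r) ^ 2 ≠ 0 := by positivity
    have hl : HasDerivAt (fun t : ℝ ↦ t * r) r t := by simpa using (hasDerivAt_id t).mul_const r
    have h1 := (hl.arctan).ofReal_comp
    have h2 := (((hl.pow 2).const_add 1).log h0).ofReal_comp
    refine (h1.sub (h2.const_mul (Complex.I / 2))).congr_deriv ?_
    have h3 : (1 : ℂ) + (t * r) ^ 2 ≠ 0 := by exact_mod_cast h0
    have h4 : (1 : ℂ) + t * Complex.I * r ≠ 0 := by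
      intro h
      have := congrArg Complex.re h
      simp at this
    push_cast [Pi.pow_apply]
    rw [eq_div_iff h4]
    have h5 := mul_inv_cancel₀ h3
    simp only [div_eq_mul_inv]
    linear_combination (r : ℂ) * h5 -
      (1 + ((t : ℂ) * r) ^ 2)⁻¹ * (r : ℂ) ^ 3 * (t : ℂ) ^ 2 * Complex.I_sq
  rw [intervalIntegral.integral_eq_sub_of_hasDerivAt (fun t _ ↦ hd t)]
  · rw [neg_mul, Real.arctan_neg, neg_sq]
    push_cast
    ring
  · refine Continuous.intervalIntegrable ?_ _ _
    refine Continuous.div (by fun_prop) (by fun_prop) fun t h ↦ ?_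
    have := congrArg Complex.re h
    simp at this

namespace IsGapped

variable {𝓗 : Type*} [NormedAddCommGroup 𝓗] [InnerProductSpace ℂ 𝓗] [CompleteSpace 𝓗]
variable {A : 𝓗 →ₗ.[ℂ] 𝓗} {εF a : ℝ} (h : IsGapped A εF a)

/-- Functions of the resolvent at `εF`, through its continuous functional calculus. -/
def calculus : C(spectrum ℂ (resolvent A εF), ℂ) →⋆ₐ[ℂ] (𝓗 →L[ℂ] 𝓗) :=
  cfcHom h.isSelfAdjoint.isStarNormal

theorem norm_calculus (G : C(spectrum ℂ (resolvent A εF), ℂ)) : ‖h.calculus G‖ = ‖G‖ :=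
  norm_cfcHom _ G h.isSelfAdjoint.isStarNormal

theorem calculus_id :
    h.calculus (ContinuousMap.restrict (spectrum ℂ (resolvent A εF)) (.id ℂ)) =
      resolvent A εF := cfcHom_id h.isSelfAdjoint.isStarNormal

/-- The functional `G ↦ ⟨f, G(T) f⟩`, where `T = (εF - A)⁻¹`. -/
def calculusForm (f : 𝓗) : C(spectrum ℂ (resolvent A εF), ℂ) →L[ℂ] ℂ :=
  LinearMap.mkContinuous
    ((innerₛₗ ℂ f).comp ((ContinuousLinearMap.apply ℂ 𝓗 f).toLinearMap.comp
      h.calculus.toAlgHom.toLinearMap)) (‖f‖ ^ 2) fun G ↦ by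
    have h1 := norm_inner_le_norm (𝕜 := ℂ) f (h.calculus G f)
    have h2 := (h.calculus G).le_opNorm f
    rw [h.norm_calculus] at h2
    calc _ ≤ ‖f‖ * ‖h.calculus G f‖ := h1
      _ ≤ ‖f‖ * (‖G‖ * ‖f‖) := by gcongr
      _ = _ := by ring

theorem calculusForm_apply (f : 𝓗) (G : C(spectrum ℂ (resolvent A εF), ℂ)) :
    h.calculusForm f G = inner ℂ f (h.calculus G f) := rfl

theorem norm_calculusForm_le (f : 𝓗) (G : C(spectrum ℂ (resolvent A εF), ℂ)) :
    ‖h.calculusForm f G‖ ≤ ‖f‖ ^ 2 * ‖G‖ :=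
  (h.calculusForm f).le_of_opNorm_le (LinearMap.mkContinuous_norm_le _ (by positivity) _) G

theorem continuousMap_intervalIntegral_apply {X : Type*} [TopologicalSpace X] [CompactSpace X]
    {F : ℝ → C(X, ℂ)} {p q : ℝ} (hF : IntervalIntegrable F volume p q) (s : X) :
    (∫ t in p..q, F t) s = ∫ t in p..q, F t s :=
  ((ContinuousMap.evalCLM ℂ s).intervalIntegral_comp_comm hF).symm

include h

/-- The mollified density is the expectation of the spectral projection on the occupied states:
the symbol `G` is the indicator function of the occupied spectrum in the variable
`s = (εF - λ)⁻¹`. -/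
theorem exists_mollifiedDensity_eq {c : ℝ → ℂ} (hc : IsContour c) (hs : Separates c A εF) :
    ∃ G : C(spectrum ℂ (resolvent A εF), ℂ),
      (∀ s : spectrum ℂ (resolvent A εF), 0 < (s : ℂ).re → G s = 1) ∧
      (∀ s : spectrum ℂ (resolvent A εF), (s : ℂ).re ≤ 0 → G s = 0) ∧
      ∀ f, mollifiedDensity A c f = h.calculusForm f G := by
  -- `c` is only controlled on `[0, 1]`; extend it by constants to a continuous path on `ℝ`
  set ζ : ℝ → ℂ := fun t ↦ c (Set.projIcc 0 1 zero_le_one t) with hζ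
  have hζc : Continuous ζ :=
    hc.continuousOn.comp_continuous (continuous_subtype_val.comp continuous_projIcc)
      fun t ↦ (Set.projIcc (0 : ℝ) 1 zero_le_one t).2
  have hζe : ∀ t ∈ Set.uIcc (0 : ℝ) 1, ζ t = c t := fun t ht ↦ by
    rw [Set.uIcc_of_le zero_le_one] at ht
    simp only [hζ, Set.projIcc_of_mem zero_le_one ht]
  have hres : ∀ t, ζ t ∈ resolventSet A := fun t ↦ by
    have := hs.avoids _ (Set.projIcc (0 : ℝ) 1 zero_le_one t).2
    rwa [spec, Set.notMem_compl_iff] at this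
  obtain ⟨F, hF⟩ := exists_symbol A (εF := εF) hζc fun t s ↦
    one_add_mul_ne_zero h.isResolventAt (hres t)
  have hint : IntervalIntegrable (fun t ↦ deriv c t • F t) volume 0 1 :=
    hc.intervalIntegrable_deriv.smul_continuousOn F.continuous.continuousOn
  have key : ∀ s : spectrum ℂ (resolvent A εF), (s : ℂ) ≠ 0 →
      ((2 * Real.pi * Complex.I)⁻¹ • ∫ t in (0 : ℝ)..1, deriv c t • F t) s =
        windingNumber c (εF - (s : ℂ).re⁻¹ : ℝ) := by
    intro s h₀
    rw [ContinuousMap.smul_apply, continuousMap_intervalIntegral_apply hint, windingNumber,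
      contourIntegral, smul_eq_mul]
    congr 1
    refine intervalIntegral.integral_congr fun t ht ↦ ?_
    simp only [ContinuousMap.smul_apply, smul_eq_mul]
    rw [hF, hζe t ht, mul_comm]
    congr 1
    rw [h.spectrum_real s.2] at h₀ ⊢
    push_cast at h₀ ⊢
    have e : 1 + (c t - εF) * ((s : ℂ).re : ℂ) =
        ((s : ℂ).re : ℂ) * (c t - (εF - ((s : ℂ).re : ℂ)⁻¹)) := by
      field_simp
      ring
    simp only [Complex.ofReal_re]
    rw [e, div_mul_cancel_left₀ h₀]
  refine ⟨(2 * Real.pi * Complex.I)⁻¹ • ∫ t in (0 : ℝ)..1, deriv c t • F t, ?_, ?_, ?_⟩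
  · intro s hpos
    have h₀ : (s : ℂ) ≠ 0 := by intro h0; simp [h0] at hpos
    rw [key s h₀]
    refine hs.occupied _ ⟨h.mem_spec_of_ne_zero s.2 h₀, ?_⟩
    have := inv_pos.mpr hpos
    linarith
  · intro s hle
    by_cases h₀ : (s : ℂ) = 0
    · rw [ContinuousMap.smul_apply, continuousMap_intervalIntegral_apply hint]
      simp [hF, h₀]
    · rw [key s h₀]
      refine hs.unoccupied _ ⟨h.mem_spec_of_ne_zero s.2 h₀, ?_⟩
      have hlt : (s : ℂ).re < 0 := by
        refine lt_of_le_of_ne hle fun h0 ↦ h₀ ?_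
        rw [h.spectrum_real s.2, h0, Complex.ofReal_zero]
      have := inv_lt_zero.mpr hlt
      linarith
  · intro f
    rw [mollifiedDensity, contourIntegral, map_smul, smul_eq_mul,
      ← (h.calculusForm f).intervalIntegral_comp_comm hint]
    congr 1
    refine intervalIntegral.integral_congr fun t ht ↦ ?_
    simp only [map_smul, smul_eq_mul]
    rw [mul_comm, calculusForm_apply, calculus, ← h.resolvent_eq_cfcHom (hres t) (hF t), hζe t ht]

theorem norm_mollifiedDensity_le {c : ℝ → ℂ} (hc : IsContour c) (hs : Separates c A εF) (f : 𝓗) :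
    ‖mollifiedDensity A c f‖ ≤ ‖f‖ ^ 2 := by
  obtain ⟨G, h1, h0, hG⟩ := h.exists_mollifiedDensity_eq hc hs
  rw [hG]
  refine (h.norm_calculusForm_le f G).trans (mul_le_of_le_one_right (by positivity) ?_)
  refine (ContinuousMap.norm_le _ zero_le_one).mpr fun s ↦ ?_
  rcases lt_or_ge 0 (s : ℂ).re with hs | hs
  · simp [h1 s hs]
  · simp [h0 s hs]

/-- The contour can be replaced by the vertical line through `εF`: the principal value of the
integral of the resolvent along this line is the spectral projection minus `1 / 2`. -/
theorem tendsto_integral_line {c : ℝ → ℂ} (hc : IsContour c) (hs : Separates c A εF) (f : 𝓗) :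
    Filter.Tendsto (fun N : ℝ ↦ (2 * Real.pi : ℂ)⁻¹ *
        ∫ t in -N..N, inner ℂ f (resolvent A (εF + t * Complex.I) f)) Filter.atTop
      (nhds (mollifiedDensity A c f - (1 / 2) * (‖f‖ : ℂ) ^ 2)) := by
  obtain ⟨G, h1, h0, hG⟩ := h.exists_mollifiedDensity_eq hc hs
  obtain ⟨F, hF⟩ := exists_symbol A (εF := εF) (ζ := fun t ↦ εF + t * Complex.I) (by fun_prop)
    fun t s ↦ h.one_add_I_mul_ne_zero t
  have hpi := Real.pi_pos
  have hint : ∀ N : ℝ, IntervalIntegrable F volume (-N) N := fun N ↦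
    F.continuous.intervalIntegrable _ _
  let Q : ℝ → C(spectrum ℂ (resolvent A εF), ℂ) := fun N ↦
    (2 * Real.pi : ℂ)⁻¹ • ∫ t in -N..N, F t
  have hQ : ∀ N s, Q N s = ((Real.arctan (N * (s : ℂ).re) / Real.pi : ℝ) : ℂ) := fun N s ↦ by
    simp only [Q]
    rw [ContinuousMap.smul_apply, continuousMap_intervalIntegral_apply (hint N)]
    have := integral_symbol_line N (s : ℂ).re
    rw [← h.spectrum_real s.2] at this
    simp only [hF, add_sub_cancel_left, this, smul_eq_mul]
    push_cast
    field_simp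
  -- the error `D N` does not tend to zero uniformly, since the spectrum of `(εF - A)⁻¹` may
  -- accumulate at `0`; it is bounded, and small after multiplication by `s`
  let D : ℝ → C(spectrum ℂ (resolvent A εF), ℂ) := fun N ↦ G - (1 / 2 : ℂ) • 1 - Q N
  have hD : ∀ N s, D N s = (((if 0 < (s : ℂ).re then 1 / 2 else -(1 / 2)) -
      Real.arctan (N * (s : ℂ).re) / Real.pi : ℝ) : ℂ) := fun N s ↦ by
    have : D N s = G s - (1 / 2 : ℂ) * 1 - Q N s := rfl
    rw [this, hQ]
    split_ifs with hp
    · rw [h1 s hp]; push_cast; ring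
    · rw [h0 s (not_lt.mp hp)]; push_cast; ring
  have hD1 : ∀ N, ‖D N‖ ≤ 1 := fun N ↦ by
    refine (ContinuousMap.norm_le _ zero_le_one).mpr fun s ↦ ?_
    rw [hD, Complex.norm_real, Real.norm_eq_abs]
    have ha : |Real.arctan (N * (s : ℂ).re) / Real.pi| ≤ 1 / 2 := by
      rw [abs_div, abs_of_pos hpi, div_le_iff₀ hpi, abs_le]
      constructor
      · linarith [Real.neg_pi_div_two_lt_arctan (N * (s : ℂ).re)]
      · linarith [Real.arctan_lt_pi_div_two (N * (s : ℂ).re)]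
    rw [abs_le] at ha ⊢
    split_ifs <;> constructor <;> linarith
  have hD2 : ∀ N : ℝ, 0 < N →
      ‖D N * ContinuousMap.restrict (spectrum ℂ (resolvent A εF)) (.id ℂ)‖ ≤ N⁻¹ := fun N hN ↦ by
    refine (ContinuousMap.norm_le _ (by positivity)).mpr fun s ↦ ?_
    have e : (D N * ContinuousMap.restrict (spectrum ℂ (resolvent A εF)) (.id ℂ)) s =
        D N s * (s : ℂ) := rfl
    rw [e, hD, h.spectrum_real s.2, Complex.ofReal_re, ← Complex.ofReal_mul, Complex.norm_real,
      Real.norm_eq_abs, mul_comm]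
    rcases lt_trichotomy 0 (s : ℂ).re with hp | hp | hp
    · rw [if_pos hp]; exact abs_mul_half_sub_arctan_le hN hp
    · rw [← hp]; simp [hN.le]
    · rw [if_neg hp.not_gt]
      have := abs_mul_half_sub_arctan_le hN (neg_pos.mpr hp)
      rw [mul_neg, Real.arctan_neg] at this
      convert this using 2
      ring
  have hlim : Filter.Tendsto (fun N ↦ h.calculus (D N) f) Filter.atTop (nhds 0) := by
    rw [Metric.tendsto_nhds]
    intro ε hε
    -- approximate `f` by an element `u = (εF - A)⁻¹ g` of the domain
    obtain ⟨u, hu, hfu⟩ := h.dense.exists_dist_lt f (half_pos hε)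
    set g := (εF : ℂ) • u - A ⟨u, hu⟩ with hg
    have hug : resolvent A εF g = u := h.isResolventAt.left_inv ⟨u, hu⟩
    have hN := (tendsto_inv_atTop_zero (𝕜 := ℝ)).mul_const ‖g‖
    rw [zero_mul] at hN
    filter_upwards [Filter.eventually_gt_atTop 0,
      hN.eventually (gt_mem_nhds (half_pos hε))] with N hN0 hNε
    rw [dist_zero_right]
    have e : h.calculus (D N) f = h.calculus (D N) (f - u) +
        h.calculus (D N * ContinuousMap.restrict (spectrum ℂ (resolvent A εF)) (.id ℂ)) g := by
      rw [map_mul, mul_apply_eq_comp, h.calculus_id, hug, ← map_add, sub_add_cancel]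
    rw [e]
    have e1 := (h.calculus (D N)).le_of_opNorm_le ((h.norm_calculus _).le.trans (hD1 N)) (f - u)
    have e2 := (h.calculus
      (D N * ContinuousMap.restrict (spectrum ℂ (resolvent A εF)) (.id ℂ))).le_of_opNorm_le
      ((h.norm_calculus _).le.trans (hD2 N hN0)) g
    rw [dist_eq_norm] at hfu
    calc _ ≤ _ := norm_add_le _ _
      _ < ε := by linarith
  have hform : ∀ N, h.calculusForm f (D N) = (mollifiedDensity A c f - (1 / 2) * (‖f‖ : ℂ) ^ 2) -
      (2 * Real.pi : ℂ)⁻¹ * ∫ t in -N..N, inner ℂ f (resolvent A (εF + t * Complex.I) f) := by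
    intro N
    have e1 : h.calculusForm f 1 = (‖f‖ : ℂ) ^ 2 := by
      rw [calculusForm_apply, map_one, one_apply_eq_self, inner_self_eq_norm_sq_to_K]
      rfl
    simp only [D, Q, map_sub, map_smul, smul_eq_mul, e1, hG]
    rw [← (h.calculusForm f).intervalIntegral_comp_comm (hint N)]
    congr 2
    refine intervalIntegral.integral_congr fun t _ ↦ ?_
    rw [calculusForm_apply, calculus, ← h.resolvent_eq_cfcHom (h.line_mem_resolventSet t) (hF t)]
  have h2 : Filter.Tendsto (fun N ↦ h.calculusForm f (D N)) Filter.atTop (nhds 0) := by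
    have := (tendsto_const_nhds (x := f)).inner (𝕜 := ℂ) hlim
    rwa [inner_zero_right] at this
  have h3 := h2.const_sub (mollifiedDensity A c f - (1 / 2) * (‖f‖ : ℂ) ^ 2)
  simpa [hform] using h3

theorem continuous_inner_resolvent (f : 𝓗) :
    Continuous fun t : ℝ ↦ inner ℂ f (resolvent A (εF + t * Complex.I) f) := by
  obtain ⟨F, hF⟩ := exists_symbol A (εF := εF) (ζ := fun t ↦ εF + t * Complex.I) (by fun_prop)
    fun t s ↦ h.one_add_I_mul_ne_zero t
  convert! (h.calculusForm f).continuous.comp F.continuous using 2 with t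
  rw [Function.comp_apply, calculusForm_apply, calculus,
    ← h.resolvent_eq_cfcHom (h.line_mem_resolventSet t) (hF t)]

end IsGapped

theorem integral_inv_sq_add_sq_le {a : ℝ} (ha : 0 < a) (N : ℝ) :
    ∫ t in -N..N, (a ^ 2 + t ^ 2)⁻¹ ≤ Real.pi / a := by
  have hd : ∀ t : ℝ, HasDerivAt (fun t : ℝ ↦ Real.arctan (t / a) / a) ((a ^ 2 + t ^ 2)⁻¹) t := by
    intro t
    have hl : HasDerivAt (fun t : ℝ ↦ t / a) (1 / a) t := (hasDerivAt_id t).div_const a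
    refine ((hl.arctan).div_const a).congr_deriv ?_
    have : 1 + (t / a) ^ 2 ≠ 0 := by positivity
    have : a ^ 2 + t ^ 2 ≠ 0 := by positivity
    field_simp
  rw [intervalIntegral.integral_eq_sub_of_hasDerivAt (fun t _ ↦ hd t)]
  · rw [neg_div, Real.arctan_neg, ← sub_div]
    have := Real.arctan_lt_pi_div_two (N / a)
    gcongr
    linarith
  · refine Continuous.intervalIntegrable ?_ _ _
    exact Continuous.inv₀ (by fun_prop) fun t ↦ by positivity

/-- Bounds on the difference of the resolvents of two operators on the line `re z = εF` pass to
the difference of the densities.  The terms `½‖f‖²` and `½‖g‖²` in the principal value integrals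
cancel because `f` and `g` have the same norm. -/
theorem norm_mollifiedDensity_sub_le {𝓗 𝓚 : Type*} [NormedAddCommGroup 𝓗] [InnerProductSpace ℂ 𝓗]
    [CompleteSpace 𝓗] [NormedAddCommGroup 𝓚] [InnerProductSpace ℂ 𝓚] [CompleteSpace 𝓚]
    {A : 𝓗 →ₗ.[ℂ] 𝓗} {B : 𝓚 →ₗ.[ℂ] 𝓚} {εF a : ℝ} (hA : IsGapped A εF a) (hB : IsGapped B εF a)
    {c : ℝ → ℂ} (hc : IsContour c) (hcA : Separates c A εF) (hcB : Separates c B εF)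
    {f : 𝓗} {g : 𝓚} (hfg : ‖f‖ = ‖g‖) {K : ℝ} (hK : 0 ≤ K)
    (hbound : ∀ t : ℝ, ‖inner ℂ f (resolvent A (εF + t * Complex.I) f) -
      inner ℂ g (resolvent B (εF + t * Complex.I) g)‖ ≤ K * (a ^ 2 + t ^ 2)⁻¹) :
    ‖mollifiedDensity A c f - mollifiedDensity B c g‖ ≤ K / a := by
  have ha := hA.pos
  have hpi := Real.pi_pos
  have hlim := (hA.tendsto_integral_line hc hcA f).sub (hB.tendsto_integral_line hc hcB g)
  rw [hfg, sub_sub_sub_cancel_right] at hlim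
  refine le_of_tendsto hlim.norm ?_
  filter_upwards [Filter.eventually_ge_atTop 0] with N hN
  rw [← mul_sub, ← intervalIntegral.integral_sub
    ((hA.continuous_inner_resolvent f).intervalIntegrable _ _)
    ((hB.continuous_inner_resolvent g).intervalIntegrable _ _), norm_mul]
  have h1 : ‖∫ t in -N..N, inner ℂ f (resolvent A (εF + t * Complex.I) f) -
      inner ℂ g (resolvent B (εF + t * Complex.I) g)‖ ≤
      ∫ t in -N..N, K * (a ^ 2 + t ^ 2)⁻¹ := by
    refine intervalIntegral.norm_integral_le_of_norm_le (by linarith)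
      (Filter.Eventually.of_forall fun t _ ↦ hbound t) ?_
    refine Continuous.intervalIntegrable ?_ _ _
    exact continuous_const.mul (Continuous.inv₀ (by fun_prop) fun t ↦ by positivity)
  rw [intervalIntegral.integral_const_mul] at h1
  have h2 := mul_le_mul_of_nonneg_left (integral_inv_sq_add_sq_le ha N) hK
  have h3 : ‖(2 * Real.pi : ℂ)⁻¹‖ = (2 * Real.pi)⁻¹ := by
    rw [norm_inv]; simp [abs_of_pos hpi]
  rw [h3]
  calc _ ≤ (2 * Real.pi)⁻¹ * (K * (Real.pi / a)) := by gcongr; linarith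
    _ = K / a / 2 := by field_simp
    _ ≤ K / a := by have : 0 ≤ K / a := by positivity
                    linarith

/-! ### Smooth cutoff functions -/

section Calculus

variable {d : ℕ}

/-- The standard basis of `ℝᵈ`. -/
abbrev stdBasis (d : ℕ) : OrthonormalBasis (Fin d) ℝ (Space d) := EuclideanSpace.basisFun (Fin d) ℝ

theorem laplacian_eq_sum_fderiv {F : Type*} [NormedAddCommGroup F] [NormedSpace ℝ F]
    (u : Space d → F) (x : Space d) :
    Δ u x = ∑ i, fderiv ℝ (fderiv ℝ u) x (stdBasis d i) (stdBasis d i) := by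
  rw [InnerProductSpace.laplacian_eq_iteratedFDeriv_orthonormalBasis u (stdBasis d)]
  simp [iteratedFDeriv_two_apply]

theorem norm_convolution_le {E F₁ F₂ F₃ : Type*} [NormedAddCommGroup E] [MeasurableSpace E]
    [NormedAddCommGroup F₁] [NormedSpace ℝ F₁]
    [NormedAddCommGroup F₂] [NormedSpace ℝ F₂] [NormedAddCommGroup F₃] [NormedSpace ℝ F₃]
    (L : F₁ →L[ℝ] F₂ →L[ℝ] F₃) (hL : ‖L‖ ≤ 1) {μ : Measure E} {f : E → F₁} (hf : Integrable f μ)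
    {g : E → F₂} (hg : ∀ x, ‖g x‖ ≤ 1) (x : E) :
    ‖convolution f g L μ x‖ ≤ ∫ y, ‖f y‖ ∂μ := by
  refine norm_integral_le_of_norm_le hf.norm (Filter.Eventually.of_forall fun y ↦ ?_)
  refine (L.le_opNorm₂ _ _).trans ?_
  calc ‖L‖ * ‖f y‖ * ‖g (x - y)‖ ≤ 1 * ‖f y‖ * 1 := by gcongr; exact hg _
    _ = ‖f y‖ := by ring

theorem fderiv_convolution_apply {η g : Space d → ℝ} (hη : ContDiff ℝ ∞ η)
    (hηc : HasCompactSupport η) (hg : LocallyIntegrable g volume) (x v : Space d) :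
    fderiv ℝ (convolution η g (ContinuousLinearMap.lsmul ℝ ℝ) volume) x v =
      convolution (fun y ↦ fderiv ℝ η y v) g (ContinuousLinearMap.lsmul ℝ ℝ) volume x := by
  rw [← convolution_flip, ← convolution_flip (L := ContinuousLinearMap.lsmul ℝ ℝ),
    (hηc.hasFDerivAt_convolution_right _ hg (hη.of_le (by simp)) x).fderiv]
  exact convolution_precompR_apply _ hg (hηc.fderiv (𝕜 := ℝ)) (hη.continuous_fderiv (by simp)) x v

theorem fderiv_fderiv_apply {F : Type*} [NormedAddCommGroup F] [NormedSpace ℝ F] {u : Space d → F}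
    (hu : ContDiff ℝ ∞ u) (x v w : Space d) :
    fderiv ℝ (fderiv ℝ u) x w v = fderiv ℝ (fun y ↦ fderiv ℝ u y v) x w := by
  have hu2 : Differentiable ℝ (fderiv ℝ u) :=
    (hu.fderiv_right (m := ∞) (by simp)).differentiable (by simp)
  rw [((hu2 x).hasFDerivAt.clm_apply (hasFDerivAt_const v x)).fderiv]
  simp

/-- `χ` is a smooth cutoff around `S` which vanishes near the points at distance at most `r` from `S`
and equals `1` near the points at distance at least `r + 1`, with derivatives bounded by `M`. -/
structure IsCutoff (S : Set (Space d)) (r M : ℝ) (χ : Space d → ℝ) : Prop where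
  smooth : ContDiff ℝ ∞ χ
  abs_le_one : ∀ x, |χ x| ≤ 1
  eq_zero : ∀ x, Metric.infDist x S ≤ r → χ =ᶠ[nhds x] fun _ ↦ 0
  eq_one : ∀ x, r + 1 ≤ Metric.infDist x S → χ =ᶠ[nhds x] fun _ ↦ 1
  grad_le : ∀ x, ∑ i, fderiv ℝ χ x (stdBasis d i) ^ 2 ≤ M ^ 2
  laplacian_le : ∀ x, |Δ χ x| ≤ M

/-- Smooth cutoffs exist around every set, with bounds on their derivatives that depend only on the
dimension: mollify the indicator function of `{x | r + 1/2 < infDist x S}`. -/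
theorem exists_cutoff (d : ℕ) : ∃ M : ℝ, 1 ≤ M ∧ ∀ (S : Set (Space d)) (r : ℝ),
    ∃ χ : Space d → ℝ, IsCutoff S r M χ := by
  let φ : ContDiffBump (0 : Space d) := ⟨1 / 8, 1 / 4, by norm_num, by norm_num⟩
  let η : Space d → ℝ := φ.normed volume
  have hη : ContDiff ℝ ∞ η := φ.contDiff_normed
  have hηc : HasCompactSupport η := φ.hasCompactSupport_normed
  have hi0 := hη.continuous.integrable_of_hasCompactSupport (μ := volume) hηc
  let η₁ : Fin d → Space d → ℝ := fun i y ↦ fderiv ℝ η y (stdBasis d i)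
  let η₂ : Fin d → Space d → ℝ := fun i y ↦ fderiv ℝ (η₁ i) y (stdBasis d i)
  have hη1 : ∀ i, ContDiff ℝ ∞ (η₁ i) := fun i ↦
    (hη.fderiv_right (m := ∞) (by simp)).clm_apply contDiff_const
  have hη2 : ∀ i, ContDiff ℝ ∞ (η₂ i) := fun i ↦
    ((hη1 i).fderiv_right (m := ∞) (by simp)).clm_apply contDiff_const
  have hηc1 : ∀ i, HasCompactSupport (η₁ i) := fun i ↦ hηc.fderiv_apply (𝕜 := ℝ) _
  have hηc2 : ∀ i, HasCompactSupport (η₂ i) := fun i ↦ (hηc1 i).fderiv_apply (𝕜 := ℝ) _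
  set M₁ := ∑ i, ∫ y, ‖η₁ i y‖ with hM₁
  set M₂ := ∑ i, ∫ y, ‖η₂ i y‖ with hM₂
  have hM₁0 : 0 ≤ M₁ := Finset.sum_nonneg fun _ _ ↦ integral_nonneg fun _ ↦ norm_nonneg _
  have hM₂0 : 0 ≤ M₂ := Finset.sum_nonneg fun _ _ ↦ integral_nonneg fun _ ↦ norm_nonneg _
  refine ⟨1 + (d + 1) * M₁ + d * M₂, by nlinarith [Nat.cast_nonneg (α := ℝ) d], fun S r ↦ ?_⟩
  let A : Set (Space d) := {x | r + 1 / 2 < Metric.infDist x S}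
  have hA : MeasurableSet A :=
    (isOpen_lt continuous_const (Metric.continuous_infDist_pt S)).measurableSet
  let g : Space d → ℝ := A.indicator fun _ ↦ 1
  have hg1 : ∀ x, ‖g x‖ ≤ 1 := fun x ↦ by
    by_cases hx : x ∈ A <;> simp [g, hx]
  have hgl : LocallyIntegrable g volume :=
    (locallyIntegrable_const (1 : ℝ)).indicator hA
  let L₀ := ContinuousLinearMap.lsmul ℝ ℝ (E := ℝ)
  have hL₀ : ‖L₀‖ ≤ 1 := ContinuousLinearMap.opNorm_lsmul_le
  let χ : Space d → ℝ := convolution η g L₀ volume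
  have hχ : ContDiff ℝ ∞ χ := hηc.contDiff_convolution_left L₀ hη hgl
  have hb1 : ∀ x i, |fderiv ℝ χ x (stdBasis d i)| ≤ M₁ := fun x i ↦ by
    rw [fderiv_convolution_apply hη hηc hgl]
    refine (norm_convolution_le L₀ hL₀
      ((hη1 i).continuous.integrable_of_hasCompactSupport (hηc1 i)) hg1 x).trans ?_
    exact Finset.single_le_sum (f := fun i ↦ ∫ y, ‖η₁ i y‖)
      (fun i _ ↦ integral_nonneg fun _ ↦ norm_nonneg _) (Finset.mem_univ i)
  have hb2 : ∀ x i, |fderiv ℝ (fderiv ℝ χ) x (stdBasis d i) (stdBasis d i)| ≤ M₂ := fun x i ↦ by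
    rw [fderiv_fderiv_apply hχ, funext fun y ↦ fderiv_convolution_apply hη hηc hgl y _,
      fderiv_convolution_apply (hη1 i) (hηc1 i) hgl]
    refine (norm_convolution_le L₀ hL₀
      ((hη2 i).continuous.integrable_of_hasCompactSupport (hηc2 i)) hg1 x).trans ?_
    exact Finset.single_le_sum (f := fun i ↦ ∫ y, ‖η₂ i y‖)
      (fun i _ ↦ integral_nonneg fun _ ↦ norm_nonneg _) (Finset.mem_univ i)
  -- where `g` is constant on the ball of radius `1 / 4`, mollification does not change it
  have hval : ∀ x c, (∀ y, dist y x < 1 / 4 → g y = c) → χ x = c := fun x c hc ↦ by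
    have := φ.normed_convolution_eq_right (μ := volume) (g := g) (x₀ := x) fun y hy ↦ by
      rw [hc y hy, hc x (by simp)]
    rw [hc x (by simp)] at this
    exact this
  have hdist : ∀ x y : Space d, |Metric.infDist x S - Metric.infDist y S| ≤ dist x y := fun x y ↦ by
    have := (Metric.lipschitz_infDist_pt S).dist_le_mul x y
    simpa [Real.dist_eq] using this
  refine ⟨χ, ?_, ?_, ?_, ?_, ?_, ?_⟩
  · exact hχ
  · intro x
    refine (norm_convolution_le L₀ hL₀ hi0 hg1 x).trans (le_of_eq ?_)
    rw [← φ.integral_normed (μ := volume)]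
    exact integral_congr_ae (Filter.Eventually.of_forall fun y ↦
      Real.norm_of_nonneg (φ.nonneg_normed y))
  · intro x hx
    filter_upwards [Metric.ball_mem_nhds x (ε := 1 / 4) (by norm_num)] with y hy
    refine hval y 0 fun z hz ↦ Set.indicator_of_notMem ?_ _
    simp only [A, Set.mem_ofPred_eq, not_lt]
    have h1 := (abs_le.mp (hdist z y)).2
    have h2 := (abs_le.mp (hdist y x)).2
    rw [Metric.mem_ball] at hy
    linarith
  · intro x hx
    filter_upwards [Metric.ball_mem_nhds x (ε := 1 / 4) (by norm_num)] with y hy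
    refine hval y 1 fun z hz ↦ Set.indicator_of_mem ?_ _
    simp only [A, Set.mem_ofPred_eq]
    have h1 := (abs_le.mp (hdist z y)).1
    have h2 := (abs_le.mp (hdist y x)).1
    rw [Metric.mem_ball] at hy
    linarith
  · intro x
    have h1 : ∀ i ∈ Finset.univ, fderiv ℝ χ x (stdBasis d i) ^ 2 ≤ M₁ ^ 2 := fun i _ ↦
      sq_le_sq.mpr ((hb1 x i).trans (le_abs_self _))
    have h2 := Finset.sum_le_card_nsmul _ _ _ h1
    rw [Finset.card_univ, Fintype.card_fin, nsmul_eq_mul] at h2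
    have hd0 : (0 : ℝ) ≤ d := Nat.cast_nonneg d
    have h3 : (d : ℝ) * M₁ ^ 2 ≤ ((d + 1) * M₁) ^ 2 := by
      rw [mul_pow]
      gcongr
      nlinarith
    refine h2.trans (h3.trans ?_)
    gcongr
    have : 0 ≤ d * M₂ := by positivity
    linarith
  · intro x
    rw [laplacian_eq_sum_fderiv]
    have h2 := (Finset.abs_sum_le_sum_abs _ _).trans
      (Finset.sum_le_card_nsmul Finset.univ _ _ fun i _ ↦ hb2 x i)
    rw [Finset.card_univ, Fintype.card_fin, nsmul_eq_mul] at h2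
    have : 0 ≤ (d + 1) * M₁ := by positivity
    linarith

/-! ### Test functions -/

/-- Smooth complex-valued functions with compact support on `ℝᵈ`. -/
structure IsTest (u : Space d → ℂ) : Prop where
  smooth : ContDiff ℝ ∞ u
  compact : HasCompactSupport u

/-- The product rule for the Laplacian. -/
theorem laplacian_smul_eq {χ : Space d → ℝ} {u : Space d → ℂ} (hχ : ContDiff ℝ ∞ χ)
    (hu : ContDiff ℝ ∞ u) (x : Space d) :
    Δ (fun y ↦ χ y • u y) x = χ x • Δ u x +
      2 * ∑ i, (fderiv ℝ χ x (stdBasis d i) : ℂ) * fderiv ℝ u x (stdBasis d i) +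
      (Δ χ x) • u x := by
  have hχ1 : Differentiable ℝ χ := hχ.differentiable (by simp)
  have hu1 : Differentiable ℝ u := hu.differentiable (by simp)
  have hχ2 : Differentiable ℝ (fderiv ℝ χ) :=
    (hχ.fderiv_right (m := ∞) (by simp)).differentiable (by simp)
  have hu2 : Differentiable ℝ (fderiv ℝ u) :=
    (hu.fderiv_right (m := ∞) (by simp)).differentiable (by simp)
  have h1 : fderiv ℝ (fun y ↦ χ y • u y) =
      fun y ↦ χ y • fderiv ℝ u y + (fderiv ℝ χ y).smulRight (u y) := by
    ext1 y
    exact fderiv_fun_smul (hχ1 y) (hu1 y)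
  have key : ∀ v : Space d, fderiv ℝ (fderiv ℝ (fun y ↦ χ y • u y)) x v v =
      χ x • fderiv ℝ (fderiv ℝ u) x v v + 2 * ((fderiv ℝ χ x v : ℂ) * fderiv ℝ u x v) +
        (fderiv ℝ (fderiv ℝ χ) x v v) • u x := by
    intro v
    have hD : HasFDerivAt (fun y ↦ fderiv ℝ (fun y ↦ χ y • u y) y v)
        ((χ x • (fderiv ℝ (fderiv ℝ u) x).flip v + (fderiv ℝ χ x).smulRight (fderiv ℝ u x v)) +
          ((fderiv ℝ χ x v) • fderiv ℝ u x +
            ((fderiv ℝ (fderiv ℝ χ) x).flip v).smulRight (u x))) x := by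
      have e1 : HasFDerivAt (fun y ↦ fderiv ℝ u y v) ((fderiv ℝ (fderiv ℝ u) x).flip v) x := by
        simpa using (hu2 x).hasFDerivAt.clm_apply (hasFDerivAt_const v x)
      have e2 : HasFDerivAt (fun y ↦ fderiv ℝ χ y v) ((fderiv ℝ (fderiv ℝ χ) x).flip v) x := by
        simpa using (hχ2 x).hasFDerivAt.clm_apply (hasFDerivAt_const v x)
      rw [h1]
      exact ((hχ1 x).hasFDerivAt.smul e1).add (e2.smul (hu1 x).hasFDerivAt)
    have hs : ContDiff ℝ ∞ (fun y ↦ χ y • u y) := hχ.smul hu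
    have hs2 : Differentiable ℝ (fderiv ℝ (fun y ↦ χ y • u y)) :=
      (hs.fderiv_right (m := ∞) (by simp)).differentiable (by simp)
    have hD' : HasFDerivAt (fun y ↦ fderiv ℝ (fun y ↦ χ y • u y) y v)
        ((fderiv ℝ (fderiv ℝ (fun y ↦ χ y • u y)) x).flip v) x := by
      simpa using (hs2 x).hasFDerivAt.clm_apply (hasFDerivAt_const v x)
    have := congrArg (fun T : Space d →L[ℝ] ℂ ↦ T v) (hD'.unique hD)
    simp only [ContinuousLinearMap.flip_apply] at this
    rw [this]
    simp
    ring
  simp only [laplacian_eq_sum_fderiv, key, Finset.sum_add_distrib, Finset.smul_sum,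
    Finset.mul_sum, Finset.sum_smul]

namespace IsTest

variable {u : Space d → ℂ} (hu : IsTest u)

include hu

theorem continuous : Continuous u := hu.smooth.continuous

theorem memLp (p : ℝ≥0∞) (μ : Measure (Space d)) [IsFiniteMeasureOnCompacts μ] : MemLp u p μ :=
  hu.continuous.memLp_of_hasCompactSupport hu.compact

theorem dirDeriv (v : Space d) : IsTest fun x ↦ fderiv ℝ u x v :=
  ⟨(hu.smooth.fderiv_right (m := ∞) (by simp)).clm_apply contDiff_const,
    hu.compact.fderiv_apply (𝕜 := ℝ) v⟩

theorem laplacian_eq (x : Space d) : Δ u x =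
    ∑ i, fderiv ℝ (fun y ↦ fderiv ℝ u y (stdBasis d i)) x (stdBasis d i) := by
  rw [laplacian_eq_sum_fderiv]
  exact Finset.sum_congr rfl fun i _ ↦ fderiv_fderiv_apply hu.smooth _ _ _

theorem smul {χ : Space d → ℝ} (hχ : ContDiff ℝ ∞ χ) : IsTest fun x ↦ χ x • u x :=
  ⟨hχ.smul hu.smooth, hu.compact.mono fun x hx hux ↦ hx (by simp [hux])⟩

theorem mul {w : Space d → ℂ} (hw : ContDiff ℝ ∞ w) : IsTest fun x ↦ w x * u x :=
  ⟨hw.mul hu.smooth, hu.compact.mul_left⟩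

theorem conj : IsTest fun x ↦ starRingEnd ℂ (u x) :=
  ⟨Complex.conjCLE.contDiff.comp hu.smooth, hu.compact.comp_left (map_zero _)⟩

theorem laplacian : IsTest (Δ u) := by
  have e : Δ u = fun x ↦ ∑ i, fderiv ℝ (fun y ↦ fderiv ℝ u y (stdBasis d i)) x (stdBasis d i) :=
    funext hu.laplacian_eq
  have h := fun i ↦ (hu.dirDeriv (stdBasis d i)).dirDeriv (stdBasis d i)
  refine ⟨?_, ?_⟩
  · rw [e]; exact ContDiff.sum fun i _ ↦ (h i).smooth
  · rw [e]
    have : ∀ s : Finset (Fin d), HasCompactSupport fun x ↦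
        ∑ i ∈ s, fderiv ℝ (fun y ↦ fderiv ℝ u y (stdBasis d i)) x (stdBasis d i) := by
      intro s
      induction s using Finset.induction_on with
      | empty => exact HasCompactSupport.zero
      | insert i s hi ih =>
        simp only [Finset.sum_insert hi]
        exact (h i).compact.add ih
    exact this _

theorem integral_mul_dirDeriv {w : Space d → ℂ} (hw : IsTest w) (v : Space d) :
    ∫ x, w x * fderiv ℝ u x v = -∫ x, fderiv ℝ w x v * u x := by
  refine integral_mul_fderiv_eq_neg_fderiv_mul_of_integrable ?_ ?_ ?_
    (fun x _ ↦ hw.smooth.differentiable (by simp) x) fun x _ ↦ hu.smooth.differentiable (by simp) x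
  · exact memLp_one_iff_integrable.mp ((hu.mul (hw.dirDeriv v).smooth).memLp 1 _)
  · exact memLp_one_iff_integrable.mp (((hu.dirDeriv v).mul hw.smooth).memLp 1 _)
  · exact memLp_one_iff_integrable.mp ((hu.mul hw.smooth).memLp 1 _)

theorem integral_mul_laplacian {w : Space d → ℂ} (hw : IsTest w) :
    ∫ x, w x * Δ u x = -∑ i, ∫ x, fderiv ℝ w x (stdBasis d i) * fderiv ℝ u x (stdBasis d i) := by
  simp only [hu.laplacian_eq, Finset.mul_sum]
  rw [integral_finsetSum, ← Finset.sum_neg_distrib]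
  · exact Finset.sum_congr rfl fun i _ ↦ (hu.dirDeriv _).integral_mul_dirDeriv hw _
  · exact fun i _ ↦ memLp_one_iff_integrable.mp
      ((((hu.dirDeriv _).dirDeriv _).mul hw.smooth).memLp 1 _)

theorem integral_mul_laplacian_comm {w : Space d → ℂ} (hw : IsTest w) :
    ∫ x, w x * Δ u x = ∫ x, Δ w x * u x := by
  have : ∫ x, Δ w x * u x = ∫ x, u x * Δ w x := by simp only [mul_comm]
  rw [this, hu.integral_mul_laplacian hw, hw.integral_mul_laplacian hu]
  simp only [mul_comm]

end IsTest

/-- The squared length of the gradient. -/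
def gradSq (u : Space d → ℂ) (x : Space d) : ℝ := ∑ i, ‖fderiv ℝ u x (stdBasis d i)‖ ^ 2

theorem gradSq_nonneg (u : Space d → ℂ) (x : Space d) : 0 ≤ gradSq u x :=
  Finset.sum_nonneg fun _ _ ↦ by positivity

theorem IsTest.integrable_norm_sq {u : Space d → ℂ} (hu : IsTest u) :
    Integrable (fun x ↦ ‖u x‖ ^ 2) volume :=
  (hu.memLp 2 volume).integrable_norm_pow (by norm_num)

theorem IsTest.integrable_gradSq {u : Space d → ℂ} (hu : IsTest u) :
    Integrable (gradSq u) volume :=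
  integrable_finsetSum _ fun i _ ↦ (hu.dirDeriv (stdBasis d i)).integrable_norm_sq

/-- Integration by parts for the Dirichlet integral. -/
theorem IsTest.integral_gradSq {u : Space d → ℂ} (hu : IsTest u) :
    ((∫ x, gradSq u x : ℝ) : ℂ) = -∫ x, starRingEnd ℂ (u x) * Δ u x := by
  rw [hu.integral_mul_laplacian hu.conj, neg_neg, ← integral_complex_ofReal]
  simp only [gradSq]
  push_cast
  rw [integral_finsetSum]
  · refine Finset.sum_congr rfl fun i _ ↦ integral_congr_ae
      (Filter.Eventually.of_forall fun x ↦ ?_)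
    have : fderiv ℝ (fun y ↦ starRingEnd ℂ (u y)) x (stdBasis d i) =
        starRingEnd ℂ (fderiv ℝ u x (stdBasis d i)) := by
      have := (Complex.conjCLE.toContinuousLinearMap.hasFDerivAt.comp x
        (hu.smooth.differentiable (by simp) x).hasFDerivAt).fderiv
      exact congrArg (fun T : Space d →L[ℝ] ℂ ↦ T (stdBasis d i)) this
    simp only
    rw [this, Complex.conj_mul']
  · intro i _
    have := (hu.dirDeriv (stdBasis d i)).integrable_norm_sq.ofReal (𝕜 := ℂ)
    simpa using this

end Calculus

/-! ### Schrödinger operators on test functions -/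

section Operators

variable {d : ℕ} {V : Space d → ℝ}

/-- The function `-½Δu + Vu`, for classically differentiable `u`. -/
def schrodinger (V : Space d → ℝ) (u : Space d → ℂ) (x : Space d) : ℂ :=
  -(1 / 2 : ℂ) * Δ u x + V x * u x

theorem IsTest.memLp_schrodinger {u : Space d → ℂ} (hu : IsTest u) {μ : Measure (Space d)}
    [IsFiniteMeasureOnCompacts μ] (hV : MemLp V ∞ μ) : MemLp (schrodinger V u) 2 μ :=
  ((hu.laplacian.memLp 2 μ).const_mul _).add
    (MemLp.mul' (p := ∞) (q := 2) (hu.memLp 2 μ) hV.ofReal)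

theorem IsTest.isTestFunction_comp {ψ : Space d → ℂ} (hψ : IsTest ψ)
    {U : Set (Space d)} (hU : tsupport ψ ⊆ U) (L : ℂ →L[ℝ] ℝ) : IsTestFunction U (L ∘ ψ) where
  smooth := L.contDiff.comp hψ.smooth
  compact := hψ.compact.comp_left (map_zero L)
  subset := (closure_mono (Function.support_comp_subset (map_zero L) ψ)).trans hU

/-- The weak Laplacian can be tested against complex test functions. -/
theorem IsWeakLaplacian.integral_mul {U : Set (Space d)} {μ : Measure (Space d)}
    [IsFiniteMeasureOnCompacts μ] {u l : Lp ℂ 2 μ} (h : IsWeakLaplacian U μ u l)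
    {ψ : Space d → ℂ} (hψ : IsTest ψ) (hU : tsupport ψ ⊆ U) :
    ∫ y, Δ ψ y * u y ∂μ = ∫ y, ψ y * l y ∂μ := by
  have key : ∀ {χ : Space d → ℂ}, IsTest χ → ∀ w : Lp ℂ 2 μ, ∫ y, χ y * w y ∂μ =
      (∫ y, (χ y).re • w y ∂μ) + Complex.I * ∫ y, (χ y).im • w y ∂μ := by
    intro χ hχ w
    rw [← integral_const_mul, ← integral_add]
    · refine integral_congr_ae (Filter.Eventually.of_forall fun y ↦ ?_)
      simp only [Complex.real_smul]
      nth_rw 1 [← Complex.re_add_im (χ y)]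
      ring
    · exact integrable_smul_lp (Complex.continuous_re.comp hχ.continuous)
        (hχ.compact.comp_left Complex.zero_re) w
    · exact (integrable_smul_lp (Complex.continuous_im.comp hχ.continuous)
        (hχ.compact.comp_left Complex.zero_im) w).const_mul _
  have hΔ : ∀ (L : ℂ →L[ℝ] ℝ) (y : Space d), L (Δ ψ y) = Δ (L ∘ ψ) y := fun L y ↦
    ((hψ.smooth.contDiffAt.of_le two_le).laplacian_CLM_comp_left (l := L)).symm
  have hre := h _ (IsTest.isTestFunction_comp hψ hU Complex.reCLM)
  have him := h _ (IsTest.isTestFunction_comp hψ hU Complex.imCLM)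
  simp only [← hΔ, Complex.reCLM_apply, Complex.imCLM_apply, Function.comp_apply] at hre him
  rw [key hψ.laplacian, key hψ, hre, him]

theorem inner_toLp {μ : Measure (Space d)} {f : Space d → ℂ} (hf : MemLp f 2 μ) (u : Lp ℂ 2 μ) :
    inner ℂ (hf.toLp f) u = ∫ y, starRingEnd ℂ (f y) * u y ∂μ := by
  rw [L2.inner_def]
  refine integral_congr_ae ?_
  filter_upwards [hf.coeFn_toLp] with y hy
  rw [hy, RCLike.inner_apply, mul_comm]

theorem IsTest.laplacian_conj {ψ : Space d → ℂ} (hψ : IsTest ψ) (y : Space d) :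
    Δ (fun x ↦ starRingEnd ℂ (ψ x)) y = starRingEnd ℂ (Δ ψ y) :=
  (hψ.smooth.contDiffAt.of_le two_le).laplacian_CLM_comp_left
    (l := Complex.conjCLE.toContinuousLinearMap)

/-- On test functions `-½Δ + V` is a formal adjoint of the maximal realization. -/
theorem inner_schrodinger_eq {U : Set (Space d)} {μ : Measure (Space d)}
    [IsFiniteMeasureOnCompacts μ] (hV : MemLp V ∞ μ) {u g : Lp ℂ 2 μ}
    (hug : (u, g) ∈ maxGraph V U μ) {ψ : Space d → ℂ} (hψ : IsTest ψ) (hU : tsupport ψ ⊆ U) :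
    inner ℂ ((hψ.memLp_schrodinger hV).toLp _) u = inner ℂ ((hψ.memLp 2 μ).toLp ψ) g := by
  obtain ⟨l, hl, hg⟩ := hug
  have hU' : tsupport (fun x ↦ starRingEnd ℂ (ψ x)) ⊆ U :=
    (closure_mono (Function.support_comp_subset (map_zero (starRingEnd ℂ)) ψ)).trans hU
  have hw := hl.integral_mul hψ.conj hU'
  simp only [hψ.laplacian_conj] at hw
  rw [inner_toLp, inner_toLp]
  have i1 : Integrable (fun y ↦ starRingEnd ℂ (Δ ψ y) * u y) μ :=
    memLp_one_iff_integrable.mp ((Lp.memLp u).mul' (p := 2) (q := 2) (hψ.laplacian.conj.memLp 2 μ))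
  have i2 : Integrable (fun y ↦ starRingEnd ℂ (ψ y) * l y) μ :=
    memLp_one_iff_integrable.mp ((Lp.memLp l).mul' (p := 2) (q := 2) (hψ.conj.memLp 2 μ))
  have i3 : Integrable (fun y ↦ V y * (starRingEnd ℂ (ψ y) * u y)) μ := by
    have := (memLp_one_iff_integrable.mpr (memLp_one_iff_integrable.mp
      ((Lp.memLp u).mul' (p := 2) (q := 2) (r := 1) (hψ.conj.memLp 2 μ)))).mul'
      (p := ∞) (q := 1) (r := 1) (hV.ofReal (K := ℂ))
    exact memLp_one_iff_integrable.mp this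
  calc ∫ y, starRingEnd ℂ (schrodinger V ψ y) * u y ∂μ
      = ∫ y, -(1 / 2 : ℂ) * (starRingEnd ℂ (Δ ψ y) * u y) +
          V y * (starRingEnd ℂ (ψ y) * u y) ∂μ := by
        refine integral_congr_ae (Filter.Eventually.of_forall fun y ↦ ?_)
        simp only [schrodinger, map_add, map_mul, map_neg, map_div₀, map_one, map_ofNat,
          Complex.conj_ofReal]
        ring
    _ = ∫ y, -(1 / 2 : ℂ) * (starRingEnd ℂ (ψ y) * l y) +
          V y * (starRingEnd ℂ (ψ y) * u y) ∂μ := by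
        rw [integral_add (i1.const_mul _) i3, integral_add (i2.const_mul _) i3,
          integral_const_mul, integral_const_mul, hw]
    _ = _ := by
        refine integral_congr_ae ?_
        filter_upwards [hg] with y hy
        rw [hy]
        ring

theorem IsTest.mem_maxGraph {u : Space d → ℂ} (hu : IsTest u) (hV : MemLp V ∞ volume) :
    ((hu.memLp 2 volume).toLp u, (hu.memLp_schrodinger hV).toLp _) ∈
      maxGraph V Set.univ volume := by
  refine ⟨(hu.laplacian.memLp 2 volume).toLp _, fun ψ hψ ↦ ?_, ?_⟩
  · have hψ' : IsTest (fun x ↦ (ψ x : ℂ)) :=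
      ⟨Complex.ofRealCLM.contDiff.comp hψ.smooth, hψ.compact.comp_left Complex.ofReal_zero⟩
    have e : ∀ y, Δ (fun x ↦ (ψ x : ℂ)) y = (Δ ψ y : ℂ) := fun y ↦
      (hψ.smooth.contDiffAt.of_le two_le).laplacian_CLM_comp_left (l := Complex.ofRealCLM)
    have h := hu.integral_mul_laplacian_comm hψ'
    simp only [e] at h
    have e1 : ∫ y, Δ ψ y • ((hu.memLp 2 volume).toLp u) y = ∫ y, (Δ ψ y : ℂ) * u y := by
      refine integral_congr_ae ?_
      filter_upwards [(hu.memLp 2 volume).coeFn_toLp] with y hy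
      rw [hy, Complex.real_smul]
    have e2 : ∫ y, ψ y • ((hu.laplacian.memLp 2 volume).toLp (Δ u)) y =
        ∫ y, (ψ y : ℂ) * Δ u y := by
      refine integral_congr_ae ?_
      filter_upwards [(hu.laplacian.memLp 2 volume).coeFn_toLp] with y hy
      rw [hy, Complex.real_smul]
    simp only [e1, e2, h]
  · filter_upwards [(hu.memLp 2 volume).coeFn_toLp, (hu.laplacian.memLp 2 volume).coeFn_toLp,
      (hu.memLp_schrodinger hV).coeFn_toLp] with y h1 h2 h3
    simp only [h1, h2, h3, schrodinger]

theorem toLp_mem_sobolevTwo (f : 𝓢(Space d, ℂ)) : f.toLp 2 volume ∈ sobolevTwo d := by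
  change TemperedDistribution.MemSobolev 2 2 ((f.toLp 2 volume : Lp ℂ 2 volume) : 𝓢'(Space d, ℂ))
  rw [Lp.toTemperedDistribution_toLp_eq]
  exact f.memSobolev

theorem IsTest.mem_sobolevTwo {u : Space d → ℂ} (hu : IsTest u) :
    (hu.memLp 2 volume).toLp u ∈ sobolevTwo d :=
  toLp_mem_sobolevTwo (hu.compact.toSchwartzMap hu.smooth)

theorem mem_graph_hamiltonian {u g : Lp ℂ 2 (volume : Measure (Space d))} :
    (u, g) ∈ (hamiltonian V).graph ↔ u ∈ sobolevTwo d ∧ (u, g) ∈ maxGraph V Set.univ volume := by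
  rw [← graph_maxOp_univ, LinearPMap.mem_graph_iff, LinearPMap.mem_graph_iff]
  constructor
  · rintro ⟨⟨y, hy⟩, rfl, hyg⟩
    have hle : hamiltonian V ≤ maxOp V Set.univ volume := LinearPMap.domRestrict_le
    exact ⟨hy.1, ⟨y, hle.1 hy⟩, rfl, (hle.2 rfl).symm.trans hyg⟩
  · rintro ⟨hs, ⟨y, hy⟩, rfl, hyg⟩
    exact ⟨⟨y, hs, hy⟩, rfl, hyg⟩

theorem IsTest.mem_graph_hamiltonian {u : Space d → ℂ} (hu : IsTest u)
    (hV : MemLp V ∞ volume) : ((hu.memLp 2 volume).toLp u, (hu.memLp_schrodinger hV).toLp _) ∈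
      (hamiltonian V).graph :=
  DivideAndConquer.mem_graph_hamiltonian.mpr ⟨hu.mem_sobolevTwo, hu.mem_maxGraph hV⟩

theorem dense_hamiltonian_domain (hV : MemLp V ∞ volume) :
    Dense ((hamiltonian V).domain : Set (Lp ℂ 2 (volume : Measure (Space d)))) := by
  rw [hamiltonian_domain hV]
  refine (SchwartzMap.denseRange_toLpCLM (E := Space d) (F := ℂ) (p := 2) (μ := volume)
    (by norm_num)).mono ?_
  rintro _ ⟨f, rfl⟩
  exact toLp_mem_sobolevTwo f

/-- Test functions supported in `U` belong to the domain of every self-adjoint restriction. -/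
theorem IsRestriction.mem_graph {U : Set (Space d)} (hU : IsOpen U)
    {B : Lp ℂ 2 (volume.restrict U) →ₗ.[ℂ] Lp ℂ 2 (volume.restrict U)} (hB : IsRestriction V U B)
    (hV : MemLp V ∞ (volume.restrict U)) {ψ : Space d → ℂ} (hψ : IsTest ψ)
    (hψU : tsupport ψ ⊆ U) :
    ((hψ.memLp 2 (volume.restrict U)).toLp ψ, (hψ.memLp_schrodinger hV).toLp _) ∈ B.graph := by
  have hdense := hB.selfAdjoint.dense_domain
  have key : ∀ x : B.domain, inner ℂ ((hψ.memLp_schrodinger hV).toLp _) (x : Lp ℂ 2 _) =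
      inner ℂ ((hψ.memLp 2 (volume.restrict U)).toLp ψ) (B x) := by
    intro x
    refine inner_schrodinger_eq hV ?_ hψ hψU
    rw [← graph_maxOp V hU]
    exact LinearPMap.le_graph_of_le hB.le_maxOp (B.mem_graph x)
  have hsa := LinearPMap.isSelfAdjoint_def.mp hB.selfAdjoint
  have hmem := LinearPMap.mem_adjoint_domain_of_exists _ ⟨_, key⟩
  have := LinearPMap.adjoint_apply_eq hdense ⟨_, hmem⟩ key
  have hg := (LinearPMap.adjoint B).mem_graph ⟨_, hmem⟩
  rw [this] at hg
  rw [← hsa]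
  exact hg

theorem IsRestriction.isFormalAdjoint {U : Set (Space d)}
    {B : Lp ℂ 2 (volume.restrict U) →ₗ.[ℂ] Lp ℂ 2 (volume.restrict U)} (hB : IsRestriction V U B) :
    B.IsFormalAdjoint B := by
  have h := LinearPMap.adjoint_isFormalAdjoint hB.selfAdjoint.dense_domain
  rwa [LinearPMap.isSelfAdjoint_def.mp hB.selfAdjoint] at h

end Operators

/-! ### Density of test functions in `H²` -/

section Density

variable {d : ℕ} {V : Space d → ℝ}

open FourierTransform in
/-- Bounded Fourier multipliers are bounded on `L²`. -/
theorem exists_fourierMultiplier_eq {g : Space d → ℂ} (hg : g.HasTemperateGrowth) {C : ℝ}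
    (hC : ∀ x, ‖g x‖ ≤ C) (f : Lp ℂ 2 (volume : Measure (Space d))) :
    ∃ k : Lp ℂ 2 (volume : Measure (Space d)),
      TemperedDistribution.fourierMultiplierCLM ℂ g (f : 𝓢'(Space d, ℂ)) = k ∧
        ‖k‖ ≤ C * ‖f‖ := by
  have hmem : MemLp g ∞ (volume : Measure (Space d)) :=
    memLp_top_of_bound hg.1.continuous.aestronglyMeasurable C (Filter.Eventually.of_forall hC)
  have hC0 : 0 ≤ C := (norm_nonneg _).trans (hC 0)
  refine ⟨𝓕⁻ (hmem.toLp g • 𝓕 f : Lp ℂ 2 volume), ?_, ?_⟩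
  · rw [TemperedDistribution.fourierMultiplierCLM_apply, Lp.fourier_toTemperedDistribution_eq,
      ← Lp.toTemperedDistribution_smul_eq (p := ∞) (q := 2) (r := 2) hg hmem, Lp.fourierInv_toTemperedDistribution_eq]
  · have h1 : ‖(𝓕⁻ (hmem.toLp g • 𝓕 f : Lp ℂ 2 volume) : Lp ℂ 2 volume)‖ =
        ‖(hmem.toLp g • 𝓕 f : Lp ℂ 2 volume)‖ :=
      (Lp.fourierTransformₗᵢ (Space d) ℂ).symm.norm_map _
    have h2 : ‖hmem.toLp g‖ ≤ C := by
      rw [Lp.norm_toLp]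
      refine ENNReal.toReal_le_of_le_ofReal hC0 ?_
      rw [eLpNorm_exponent_top]
      exact eLpNormEssSup_le_of_ae_bound (Filter.Eventually.of_forall hC)
    rw [h1]
    refine (Lp.norm_smul_le _ _).trans ?_
    rw [Lp.norm_fourier_eq]
    gcongr

theorem toTemperedDistribution_injective {f g : Lp ℂ 2 (volume : Measure (Space d))}
    (h : (f : 𝓢'(Space d, ℂ)) = (g : 𝓢'(Space d, ℂ))) : f = g := by
  have hk := Lp.ker_toTemperedDistributionCLM_eq_bot (F := ℂ) (μ := (volume : Measure (Space d)))
    (p := 2)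
  exact LinearMap.ker_eq_bot.mp hk h

/-- Schwartz functions are dense in `H²(ℝᵈ)`: the functions and their Laplacians converge in `L²`. -/
theorem exists_schwartz_near {u : Lp ℂ 2 (volume : Measure (Space d))} (hu : u ∈ sobolevTwo d) :
    ∃ l : Lp ℂ 2 (volume : Measure (Space d)),
      Δ (u : 𝓢'(Space d, ℂ)) = (l : 𝓢'(Space d, ℂ)) ∧ ∀ ε > 0, ∃ s : 𝓢(Space d, ℂ),
        ‖s.toLp 2 volume - u‖ < ε ∧ ‖(Δ s).toLp 2 volume - l‖ < ε := by
  have h : TemperedDistribution.MemSobolev (2 - 2) 2 (Δ (u : 𝓢'(Space d, ℂ))) :=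
    TemperedDistribution.MemSobolev.laplacian hu
  rw [sub_self, TemperedDistribution.memSobolev_zero_iff] at h
  obtain ⟨l, hl⟩ := h
  refine ⟨l, hl, fun ε hε ↦ ?_⟩
  obtain ⟨g, hg⟩ := hu
  -- `u` and `Δu` are `m g` and a multiple of `m q g` on the Fourier side, with `g ∈ L²` and with
  -- bounded multipliers `m` and `m q`; approximate `g` by a Schwartz function
  let m : Space d → ℂ := fun x ↦ ((1 + ‖x‖ ^ 2) ^ ((-2 : ℝ) / 2) : ℝ)
  have hm : m.HasTemperateGrowth := by fun_prop
  have hmval : ∀ x, m x = ((1 + ‖x‖ ^ 2)⁻¹ : ℝ) := fun x ↦ by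
    simp only [m]
    rw [show (-2 : ℝ) / 2 = -1 by norm_num, Real.rpow_neg_one]
  have hm1 : ∀ x, ‖m x‖ ≤ 1 := fun x ↦ by
    rw [hmval, Complex.norm_real, Real.norm_of_nonneg (by positivity)]
    exact inv_le_one_of_one_le₀ (by nlinarith [sq_nonneg ‖x‖])
  let q : Space d → ℂ := fun x ↦ Complex.ofReal (‖x‖ ^ 2)
  have hq : q.HasTemperateGrowth := by fun_prop
  have hmq : (m * q).HasTemperateGrowth := hm.mul hq
  have hmq1 : ∀ x, ‖(m * q) x‖ ≤ 1 := fun x ↦ by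
    rw [Pi.mul_apply, hmval, ← Complex.ofReal_mul, Complex.norm_real,
      Real.norm_of_nonneg (by positivity), inv_mul_le_iff₀ (by positivity)]
    linarith
  have hπ : 0 < 1 + (2 * Real.pi) ^ 2 := by positivity
  obtain ⟨s, hs⟩ := (SchwartzMap.denseRange_toLpCLM (E := Space d) (F := ℂ) (p := 2)
    (μ := volume) (by norm_num)).exists_dist_lt g (div_pos hε hπ)
  rw [dist_comm, dist_eq_norm, SchwartzMap.toLpCLM_apply] at hs
  have hs1 : ‖s.toLp 2 volume - g‖ < ε := hs.trans_le (div_le_self hε.le (by nlinarith))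
  let ψ : 𝓢(Space d, ℂ) := SchwartzMap.fourierMultiplierCLM ℂ m s
  have hu' : (u : 𝓢'(Space d, ℂ)) =
      TemperedDistribution.fourierMultiplierCLM ℂ m (g : 𝓢'(Space d, ℂ)) :=
    ((TemperedDistribution.besselPotential_neg_apply_eq_iff 2 (g : 𝓢'(Space d, ℂ))
      (u : 𝓢'(Space d, ℂ))).mpr hg).symm
  have hψ : (ψ : 𝓢'(Space d, ℂ)) =
      TemperedDistribution.fourierMultiplierCLM ℂ m (s.toLp 2 volume : 𝓢'(Space d, ℂ)) := by
    rw [Lp.toTemperedDistribution_toLp_eq,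
      TemperedDistribution.fourierMultiplierCLM_toTemperedDistributionCLM_eq hm]
  have hsub : ∀ a b : Lp ℂ 2 (volume : Measure (Space d)), ((a - b : Lp ℂ 2 volume) :
      𝓢'(Space d, ℂ)) = (a : 𝓢'(Space d, ℂ)) - (b : 𝓢'(Space d, ℂ)) := fun a b ↦ by
    simp only [← Lp.toTemperedDistributionCLM_apply, map_sub]
  obtain ⟨k₁, hk₁, hn₁⟩ := exists_fourierMultiplier_eq hm hm1 (s.toLp 2 volume - g)
  obtain ⟨k₂, hk₂, hn₂⟩ := exists_fourierMultiplier_eq hmq hmq1 (s.toLp 2 volume - g)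
  have hΔ : ∀ f : 𝓢'(Space d, ℂ), Δ (TemperedDistribution.fourierMultiplierCLM ℂ m f) =
      -(2 * Real.pi) ^ 2 • TemperedDistribution.fourierMultiplierCLM ℂ (m * q) f := fun f ↦ by
    rw [TemperedDistribution.laplacian_eq_fourierMultiplierCLM,
      TemperedDistribution.fourierMultiplierCLM_fourierMultiplierCLM_apply hm hq]
  refine ⟨ψ, ?_, ?_⟩
  · have e : ψ.toLp 2 volume - u = k₁ := toTemperedDistribution_injective (by
      rw [← hk₁, hsub, Lp.toTemperedDistribution_toLp_eq, hψ, hu', hsub, map_sub])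
    rw [e]
    linarith
  · have e : (Δ ψ).toLp 2 volume - l = (-(2 * Real.pi) ^ 2 : ℝ) • k₂ :=
      toTemperedDistribution_injective (by
        have e1 : (((-(2 * Real.pi) ^ 2 : ℝ) • k₂ : Lp ℂ 2 (volume : Measure (Space d))) :
            𝓢'(Space d, ℂ)) = (-(2 * Real.pi) ^ 2 : ℝ) • (k₂ : 𝓢'(Space d, ℂ)) := by
          simp only [← Lp.toTemperedDistributionCLM_apply]
          exact ContinuousLinearMap.map_smul_of_tower _ _ _
        rw [e1, ← hk₂, hsub, Lp.toTemperedDistribution_toLp_eq, ← hl, hu', hsub, map_sub,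
          smul_sub, ← hΔ, ← hΔ, ← hψ]
        congr 1
        exact (TemperedDistribution.laplacian_toTemperedDistributionCLM_eq ψ).symm)
    rw [e, norm_smul, Real.norm_eq_abs, abs_neg, abs_of_nonneg (by positivity)]
    have h3 : (2 * Real.pi) ^ 2 * ‖s.toLp 2 volume - g‖ < ε := by
      rw [lt_div_iff₀ hπ] at hs
      nlinarith [norm_nonneg (s.toLp 2 volume - g)]
    calc _ ≤ (2 * Real.pi) ^ 2 * (1 * ‖s.toLp 2 volume - g‖) := by gcongr
      _ < ε := by rwa [one_mul]

theorem norm_toLp_sq {α : Type*} [MeasurableSpace α] {μ : Measure α} {f : α → ℂ}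
    (hf : MemLp f 2 μ) : ‖hf.toLp f‖ ^ 2 = ∫ x, ‖f x‖ ^ 2 ∂μ := by
  have h := inner_self_eq_norm_sq_to_K (𝕜 := ℂ) (hf.toLp f)
  rw [L2.inner_def, integral_congr_ae (g := fun x ↦ ((‖f x‖ ^ 2 : ℝ) : ℂ)),
    integral_complex_ofReal] at h
  · have h' : ((‖hf.toLp f‖ ^ 2 : ℝ) : ℂ) = ((∫ x, ‖f x‖ ^ 2 ∂μ : ℝ) : ℂ) := by
      rw [h]; push_cast; rfl
    exact Complex.ofReal_injective h'
  · filter_upwards [hf.coeFn_toLp] with x hx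
    rw [hx, inner_self_eq_norm_sq_to_K]
    push_cast
    rfl

theorem tendsto_norm_toLp_zero {α : Type*} [MeasurableSpace α] {μ : Measure α} {F : ℕ → α → ℂ}
    {B : α → ℝ} (hB : Integrable B μ) (hF : ∀ n, MemLp (F n) 2 μ)
    (hle : ∀ n x, ‖F n x‖ ^ 2 ≤ B x) (hlim : ∀ x, ∀ᶠ n in Filter.atTop, F n x = 0) :
    Filter.Tendsto (fun n ↦ ‖(hF n).toLp (F n)‖) Filter.atTop (nhds 0) := by
  have h : Filter.Tendsto (fun n ↦ ∫ x, ‖F n x‖ ^ 2 ∂μ) Filter.atTop (nhds (∫ _, (0 : ℝ) ∂μ)) := by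
    refine tendsto_integral_of_dominated_convergence B
      (fun n ↦ (hF n).aestronglyMeasurable.norm.pow 2) hB
      (fun n ↦ Filter.Eventually.of_forall fun x ↦ ?_) (Filter.Eventually.of_forall fun x ↦ ?_)
    · rw [Real.norm_of_nonneg (by positivity)]
      exact hle n x
    · refine tendsto_const_nhds.congr' ?_
      filter_upwards [hlim x] with n hn
      simp [hn]
  rw [integral_zero] at h
  have h2 := h.sqrt
  rw [Real.sqrt_zero] at h2
  refine h2.congr fun n ↦ ?_
  rw [← norm_toLp_sq (hF n), Real.sqrt_sq (norm_nonneg _)]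

/-- The commutator `∇χ · ∇u + ½(Δχ)u` of `½Δ` with multiplication by `χ`, applied to `u`. -/
def cutoffCommutator (χ : Space d → ℝ) (u : Space d → ℂ) (x : Space d) : ℂ :=
  ∑ i, (fderiv ℝ χ x (stdBasis d i) : ℂ) * fderiv ℝ u x (stdBasis d i) +
    (1 / 2 : ℂ) * (Δ χ x * u x)

theorem laplacian_smul_eq_add_cutoffCommutator {χ : Space d → ℝ} {u : Space d → ℂ}
    (hχ : ContDiff ℝ ∞ χ) (hu : ContDiff ℝ ∞ u) (x : Space d) :
    Δ (fun y ↦ χ y • u y) x = χ x * Δ u x + 2 * cutoffCommutator χ u x := by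
  rw [laplacian_smul_eq hχ hu, cutoffCommutator, Complex.real_smul, Complex.real_smul]
  ring

theorem schrodinger_smul {χ : Space d → ℝ} {u : Space d → ℂ}
    (hχ : ContDiff ℝ ∞ χ) (hu : ContDiff ℝ ∞ u) (x : Space d) :
    schrodinger V (fun y ↦ χ y • u y) x = χ x * schrodinger V u x - cutoffCommutator χ u x := by
  rw [schrodinger, laplacian_smul_eq_add_cutoffCommutator hχ hu, schrodinger, Complex.real_smul]
  ring

theorem cutoffCommutator_eq_zero {χ : Space d → ℝ} {k : ℝ} {x : Space d}
    (h : χ =ᶠ[nhds x] fun _ ↦ k) (u : Space d → ℂ) : cutoffCommutator χ u x = 0 := by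
  have h1 : fderiv ℝ χ x = 0 := by rw [h.fderiv_eq, fderiv_fun_const]; rfl
  have h2 : Δ χ x = 0 := by
    have h' := (InnerProductSpace.laplacian_congr_nhds h).eq_of_nhds
    simpa using h'
  simp [cutoffCommutator, h1, h2]

theorem IsCutoff.norm_cutoffCommutator_sq_le {S : Set (Space d)} {r M : ℝ} {χ : Space d → ℝ}
    (h : IsCutoff S r M χ) (u : Space d → ℂ) (x : Space d) :
    ‖cutoffCommutator χ u x‖ ^ 2 ≤ 2 * M ^ 2 * (‖u x‖ ^ 2 + gradSq u x) := by
  have h1 : ‖∑ i, (fderiv ℝ χ x (stdBasis d i) : ℂ) * fderiv ℝ u x (stdBasis d i)‖ ^ 2 ≤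
      M ^ 2 * gradSq u x := by
    calc _ ≤ (∑ i, |fderiv ℝ χ x (stdBasis d i)| * ‖fderiv ℝ u x (stdBasis d i)‖) ^ 2 := by
          gcongr
          refine (norm_sum_le _ _).trans_eq ?_
          simp
      _ ≤ (∑ i, |fderiv ℝ χ x (stdBasis d i)| ^ 2) *
          ∑ i, ‖fderiv ℝ u x (stdBasis d i)‖ ^ 2 := Finset.sum_mul_sq_le_sq_mul_sq _ _ _
      _ ≤ _ := by
          simp only [sq_abs]
          exact mul_le_mul_of_nonneg_right (h.grad_le x) (gradSq_nonneg u x)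
  have h2 : ‖(1 / 2 : ℂ) * (Δ χ x * u x)‖ ≤ M * ‖u x‖ := by
    rw [norm_mul, norm_mul, Complex.norm_real, Real.norm_eq_abs]
    have : ‖(1 / 2 : ℂ)‖ ≤ 1 := by norm_num
    calc _ ≤ 1 * (M * ‖u x‖) := by gcongr; exact h.laplacian_le x
      _ = _ := one_mul _
  have h3 : ‖(1 / 2 : ℂ) * (Δ χ x * u x)‖ ^ 2 ≤ M ^ 2 * ‖u x‖ ^ 2 := by
    rw [← mul_pow]; gcongr
  calc _ ≤ (‖∑ i, (fderiv ℝ χ x (stdBasis d i) : ℂ) * fderiv ℝ u x (stdBasis d i)‖ +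
        ‖(1 / 2 : ℂ) * (Δ χ x * u x)‖) ^ 2 := by
        gcongr
        exact norm_add_le _ _
    _ ≤ _ := by
        refine (add_sq_le).trans ?_
        linarith

theorem contDiff_one_sub {χ : Space d → ℝ} (hχ : ContDiff ℝ ∞ χ) :
    ContDiff ℝ ∞ fun y ↦ 1 - χ y := contDiff_const.sub hχ

theorem cutoffCommutator_one_sub {χ : Space d → ℝ} (hχ : ContDiff ℝ ∞ χ) (u : Space d → ℂ)
    (x : Space d) :
    cutoffCommutator (fun y ↦ 1 - χ y) u x = -cutoffCommutator χ u x := by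
  have h1 : ∀ y, fderiv ℝ (fun y ↦ 1 - χ y) y = -fderiv ℝ χ y := fun y ↦ fderiv_const_sub 1
  have h2 : Δ (fun y ↦ 1 - χ y) x = -Δ χ x := by
    have h := (contDiff_const (c := (1 : ℝ))).contDiffAt.laplacian_sub
      ((hχ.of_le two_le).contDiffAt (x := x))
    simp only [InnerProductSpace.laplacian_const, Pi.zero_apply, zero_sub] at h
    exact h
  simp only [cutoffCommutator, h1, h2, neg_apply, Complex.ofReal_neg, neg_mul,
    Finset.sum_neg_distrib]
  ring

/-- Test functions approximate Schwartz functions together with their Laplacians. -/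
theorem exists_isTest_near_schwartz (s : 𝓢(Space d, ℂ)) {ε : ℝ} (hε : 0 < ε) :
    ∃ (ψ : Space d → ℂ) (hψ : IsTest ψ),
      ‖(hψ.memLp 2 volume).toLp ψ - s.toLp 2 volume‖ < ε ∧
        ‖(hψ.laplacian.memLp 2 volume).toLp (Δ ψ) - (Δ s).toLp 2 volume‖ < ε := by
  obtain ⟨M, hM1, hM⟩ := exists_cutoff d
  choose χ hcut using fun n : ℕ ↦ hM {0} n
  have hχ := fun n ↦ (hcut n).smooth
  have hχ1 := fun n ↦ (hcut n).abs_le_one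
  have hs : ContDiff ℝ ∞ s := s.smooth _
  have hψ : ∀ n, IsTest fun y ↦ (1 - χ n y) • s y := fun n ↦ by
    refine ⟨(contDiff_one_sub (hχ n)).smul hs, ?_⟩
    refine HasCompactSupport.intro (isCompact_closedBall (0 : Space d) (n + 1)) fun x hx ↦ ?_
    rw [Metric.mem_closedBall, not_le] at hx
    rw [((hcut n).eq_one x (by rw [Metric.infDist_singleton]; exact hx.le)).eq_of_nhds]
    simp
  have hs0 : ∀ x, ∀ᶠ n in Filter.atTop, χ n =ᶠ[nhds x] fun _ ↦ 0 := fun x ↦ by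
    filter_upwards [Filter.eventually_ge_atTop ⌈dist x 0⌉₊] with n hn
    exact (hcut n).eq_zero x (by rw [Metric.infDist_singleton]; exact Nat.ceil_le.mp hn)
  have hsL : MemLp s 2 volume := s.memLp 2 volume
  have hΔL : MemLp (Δ s : 𝓢(Space d, ℂ)) 2 volume := (Δ s).memLp 2 volume
  have i1 : Integrable (fun x ↦ ‖s x‖ ^ 2) := hsL.integrable_norm_pow (by norm_num)
  have i2 : Integrable (fun x ↦ ‖(Δ s : 𝓢(Space d, ℂ)) x‖ ^ 2) :=
    hΔL.integrable_norm_pow (by norm_num)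
  have i3 : Integrable (gradSq s) := by
    refine integrable_finsetSum _ fun i _ ↦ ?_
    have h := (SchwartzMap.memLp (LineDeriv.lineDerivOp (stdBasis d i) s : 𝓢(Space d, ℂ)) 2
      volume).integrable_norm_pow (by norm_num)
    simpa [SchwartzMap.lineDerivOp_apply_eq_fderiv] using h
  have hF : ∀ n, MemLp (fun y ↦ (1 - χ n y) • s y - s y) 2 volume := fun n ↦
    ((hψ n).memLp 2 volume).sub hsL
  have hG : ∀ n, MemLp (fun y ↦ Δ (fun y ↦ (1 - χ n y) • s y) y - (Δ s : 𝓢(Space d, ℂ)) y) 2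
      volume := fun n ↦ ((hψ n).laplacian.memLp 2 volume).sub hΔL
  have hGe : ∀ n y, Δ (fun y ↦ (1 - χ n y) • s y) y - (Δ s : 𝓢(Space d, ℂ)) y =
      -(χ n y * (Δ s : 𝓢(Space d, ℂ)) y + 2 * cutoffCommutator (χ n) s y) := fun n y ↦ by
    rw [laplacian_smul_eq_add_cutoffCommutator (contDiff_one_sub (hχ n)) hs,
      cutoffCommutator_one_sub (hχ n), SchwartzMap.laplacian_apply]
    push_cast
    ring
  have t1 := tendsto_norm_toLp_zero i1 hF (fun n x ↦ by
    rw [show (1 - χ n x) • s x - s x = -(χ n x • s x) by rw [sub_smul, one_smul]; ring,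
      norm_neg, norm_smul]
    have : ‖χ n x‖ ≤ 1 := hχ1 n x
    gcongr
    calc _ ≤ 1 * ‖s x‖ := by gcongr
      _ = _ := one_mul _) (fun x ↦ by
    filter_upwards [hs0 x] with n hn
    simp [hn.eq_of_nhds])
  have t2 := tendsto_norm_toLp_zero ((i2.const_mul 2).add ((i1.add i3).const_mul (16 * M ^ 2))) hG
    (fun n x ↦ by
      rw [hGe, norm_neg]
      have h1 := (hcut n).norm_cutoffCommutator_sq_le s x
      have h2 : ‖(χ n x : ℂ) * (Δ s : 𝓢(Space d, ℂ)) x‖ ^ 2 ≤ ‖(Δ s : 𝓢(Space d, ℂ)) x‖ ^ 2 := by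
        rw [norm_mul, Complex.norm_real]
        have : ‖χ n x‖ ≤ 1 := hχ1 n x
        gcongr
        calc _ ≤ 1 * ‖(Δ s : 𝓢(Space d, ℂ)) x‖ := by gcongr
          _ = _ := one_mul _
      have h3 : ‖2 * cutoffCommutator (χ n) s x‖ ^ 2 = 4 * ‖cutoffCommutator (χ n) s x‖ ^ 2 := by
        rw [norm_mul, mul_pow]; norm_num
      calc _ ≤ (‖(χ n x : ℂ) * (Δ s : 𝓢(Space d, ℂ)) x‖ + ‖2 * cutoffCommutator (χ n) s x‖) ^ 2 := by
            gcongr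
            exact norm_add_le _ _
        _ ≤ _ := by
            refine add_sq_le.trans ?_
            simp only [Pi.add_apply]
            linarith)
    (fun x ↦ by
      filter_upwards [hs0 x] with n hn
      rw [hGe, cutoffCommutator_eq_zero hn, hn.eq_of_nhds]
      simp)
  obtain ⟨n, h1, h2⟩ := ((t1.eventually_lt_const hε).and (t2.eventually_lt_const hε)).exists
  exact ⟨_, hψ n, h1, h2⟩

/-- Test functions form a core of the Hamiltonian. -/
theorem exists_isTest_near (hV : MemLp V ∞ volume) {u g : Lp ℂ 2 (volume : Measure (Space d))}
    (hug : (u, g) ∈ (hamiltonian V).graph) {ε : ℝ} (hε : 0 < ε) :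
    ∃ (ψ : Space d → ℂ) (hψ : IsTest ψ), ‖(hψ.memLp 2 volume).toLp ψ - u‖ < ε ∧
      ‖(hψ.memLp_schrodinger hV).toLp _ - g‖ < ε := by
  obtain ⟨hu, hmax⟩ := mem_graph_hamiltonian.mp hug
  obtain ⟨l, hl, happ⟩ := exists_schwartz_near hu
  have hlw : IsWeakLaplacian Set.univ volume u l := by
    intro ψ hψ
    have hs : HasCompactSupport (Complex.ofRealCLM ∘ ψ) := hψ.compact.comp_left rfl
    have hc : ContDiff ℝ ∞ (Complex.ofRealCLM ∘ ψ) := Complex.ofRealCLM.contDiff.comp hψ.smooth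
    have h := congrArg (fun T : 𝓢'(Space d, ℂ) ↦ T (hs.toSchwartzMap hc)) hl
    simp only [TemperedDistribution.laplacian_apply_apply, Lp.toTemperedDistribution_apply,
      SchwartzMap.laplacian_apply] at h
    have e : ∀ y, Δ (Complex.ofRealCLM ∘ ψ) y = (Δ ψ y : ℂ) := fun y ↦
      (hψ.smooth.contDiffAt.of_le two_le).laplacian_CLM_comp_left
    have e₀ : ∀ y, hs.toSchwartzMap hc y = (ψ y : ℂ) := fun y ↦ rfl
    have e₁ : (hs.toSchwartzMap hc : Space d → ℂ) = Complex.ofRealCLM ∘ ψ := rfl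
    simp only [e₀, e₁, e] at h
    simpa only [Complex.real_smul, smul_eq_mul] using h
  let W : Lp ℂ ∞ (volume : Measure (Space d)) := (hV.ofReal (K := ℂ)).toLp _
  have hW : ∀ᵐ y, W y = V y := (hV.ofReal (K := ℂ)).coeFn_toLp
  have hg : g = (-(1 / 2 : ℂ)) • l + W • u := by
    refine LinearPMap.mem_graph_snd_inj (maxOp V Set.univ volume) (x := u) (y := u) ?_ ?_ rfl
    · rw [graph_maxOp_univ]; exact hmax
    · rw [graph_maxOp_univ]
      refine ⟨l, hlw, ?_⟩
      filter_upwards [hW, Lp.coeFn_add ((-(1 / 2 : ℂ)) • l) (W • u),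
        Lp.coeFn_smul (-(1 / 2 : ℂ)) l, Lp.coeFn_lpSMul (r := 2) W u] with y h1 h2 h3 h4
      simp only [h2, Pi.add_apply, h3, h4, Pi.smul_apply, Pi.smul_apply', smul_eq_mul, h1]
  have hpos : 0 < 1 + ‖W‖ := by positivity
  have hη : 0 < ε / (1 + ‖W‖) / 2 := by positivity
  obtain ⟨s, hs1, hs2⟩ := happ _ hη
  obtain ⟨ψ, hψ, h1, h2⟩ := exists_isTest_near_schwartz s hη
  have hψg : (hψ.memLp_schrodinger hV).toLp _ =
      (-(1 / 2 : ℂ)) • (hψ.laplacian.memLp 2 volume).toLp (Δ ψ) +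
        W • (hψ.memLp 2 volume).toLp ψ := by
    refine Lp.ext ?_
    filter_upwards [hW, Lp.coeFn_add ((-(1 / 2 : ℂ)) • (hψ.laplacian.memLp 2 volume).toLp (Δ ψ))
        (W • (hψ.memLp 2 volume).toLp ψ),
      Lp.coeFn_smul (-(1 / 2 : ℂ)) ((hψ.laplacian.memLp 2 volume).toLp (Δ ψ)),
      Lp.coeFn_lpSMul (r := 2) W ((hψ.memLp 2 volume).toLp ψ), (hψ.memLp_schrodinger hV).coeFn_toLp,
      (hψ.memLp 2 volume).coeFn_toLp, (hψ.laplacian.memLp 2 volume).coeFn_toLp]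
      with y h1 h2 h3 h4 h5 h6 h7
    rw [h5, h2, Pi.add_apply, h3, h4]
    simp only [Pi.smul_apply, Pi.smul_apply', smul_eq_mul, h1, h6, h7, schrodinger]
  have k1 : ‖(hψ.memLp 2 volume).toLp ψ - u‖ < ε / (1 + ‖W‖) := by
    rw [← sub_add_sub_cancel _ (s.toLp 2 volume)]
    linarith [norm_add_le ((hψ.memLp 2 volume).toLp ψ - s.toLp 2 volume) (s.toLp 2 volume - u)]
  have k2 : ‖(hψ.laplacian.memLp 2 volume).toLp (Δ ψ) - l‖ < ε / (1 + ‖W‖) := by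
    rw [← sub_add_sub_cancel _ ((Δ s).toLp 2 volume)]
    linarith [norm_add_le ((hψ.laplacian.memLp 2 volume).toLp (Δ ψ) - (Δ s).toLp 2 volume)
      ((Δ s).toLp 2 volume - l)]
  refine ⟨ψ, hψ, k1.trans_le (div_le_self hε.le (by linarith [norm_nonneg W])), ?_⟩
  have hWs : (W • (hψ.memLp 2 volume).toLp ψ - W • u : Lp ℂ 2 volume) =
      W • ((hψ.memLp 2 volume).toLp ψ - u) := by
    rw [sub_eq_add_neg, sub_eq_add_neg, Lp.add_smul, Lp.smul_neg]
  rw [hψg, hg, add_sub_add_comm, ← smul_sub, hWs]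
  have n1 : ‖(-(1 / 2 : ℂ))‖ ≤ 1 := by norm_num
  calc _ ≤ ‖(-(1 / 2 : ℂ))‖ * ‖(hψ.laplacian.memLp 2 volume).toLp (Δ ψ) - l‖ +
        ‖W‖ * ‖(hψ.memLp 2 volume).toLp ψ - u‖ := by
        refine (norm_add_le _ _).trans ?_
        rw [norm_smul]
        gcongr
        exact Lp.norm_smul_le _ _
    _ ≤ 1 * ‖(hψ.laplacian.memLp 2 volume).toLp (Δ ψ) - l‖ +
        ‖W‖ * ‖(hψ.memLp 2 volume).toLp ψ - u‖ := by gcongr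
    _ < 1 * (ε / (1 + ‖W‖)) + ‖W‖ * (ε / (1 + ‖W‖)) :=
        add_lt_add_of_lt_of_le (by gcongr) (by gcongr)
    _ = ε := by field_simp

/-- The Hamiltonian is symmetric. -/
theorem hamiltonian_isFormalAdjoint (hV : MemLp V ∞ volume) :
    (hamiltonian V).IsFormalAdjoint (hamiltonian V) := by
  intro x y
  have hx := (hamiltonian V).mem_graph x
  have hy := (mem_graph_hamiltonian.mp ((hamiltonian V).mem_graph y)).2
  choose ψ hψ h1 h2 using fun n : ℕ ↦ exists_isTest_near hV hx (ε := 1 / ((n : ℝ) + 1))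
    (by positivity)
  have t1 : Filter.Tendsto (fun n ↦ ((hψ n).memLp 2 volume).toLp (ψ n)) Filter.atTop
      (nhds (x : Lp ℂ 2 volume)) := tendsto_iff_norm_sub_tendsto_zero.mpr
    (squeeze_zero (fun _ ↦ norm_nonneg _) (fun n ↦ (h1 n).le)
      tendsto_one_div_add_atTop_nhds_zero_nat)
  have t2 : Filter.Tendsto (fun n ↦ ((hψ n).memLp_schrodinger hV).toLp _) Filter.atTop
      (nhds (hamiltonian V x)) := tendsto_iff_norm_sub_tendsto_zero.mpr
    (squeeze_zero (fun _ ↦ norm_nonneg _) (fun n ↦ (h2 n).le)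
      tendsto_one_div_add_atTop_nhds_zero_nat)
  refine tendsto_nhds_unique ((t2.inner tendsto_const_nhds).congr fun n ↦ ?_)
    (t1.inner tendsto_const_nhds)
  exact inner_schrodinger_eq hV hy (hψ n) (Set.subset_univ _)


end Density

/-! ### Energy estimates -/

section Energy

variable {d : ℕ} {V : Space d → ℝ}

theorem GapAssumption.isGapped_hamiltonian {𝓚 : Type*} [NormedAddCommGroup 𝓚]
    [InnerProductSpace ℂ 𝓚] {B : 𝓚 →ₗ.[ℂ] 𝓚} {εF eg : ℝ}
    (h : GapAssumption (hamiltonian V) B εF eg) (heg : 0 < eg) (hV : MemLp V ∞ volume) :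
    IsGapped (hamiltonian V) εF (eg / 2) where
  pos := by positivity
  symm := hamiltonian_isFormalAdjoint hV
  dense := dense_hamiltonian_domain hV
  gap := fun t ht hspec ↦ by
    rcases le_or_gt t εF with hle | hlt
    · exact absurd (h.occupied_le t ⟨hspec, hle⟩) (not_le.mpr ht.1)
    · exact absurd (h.le_unoccupied t ⟨hspec, hlt⟩) (not_le.mpr ht.2)

theorem GapAssumption.isGapped_restriction {𝓗 : Type*} [NormedAddCommGroup 𝓗]
    [InnerProductSpace ℂ 𝓗] {A : 𝓗 →ₗ.[ℂ] 𝓗} {U : Set (Space d)}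
    {B : Lp ℂ 2 (volume.restrict U) →ₗ.[ℂ] Lp ℂ 2 (volume.restrict U)} {εF eg : ℝ}
    (h : GapAssumption A B εF eg) (heg : 0 < eg) (hB : IsRestriction V U B) :
    IsGapped B εF (eg / 2) where
  pos := by positivity
  symm := hB.isFormalAdjoint
  dense := hB.selfAdjoint.dense_domain
  gap := h.subsystem_gap

/-- The function `(z - (-½Δ + V))u`, for classically differentiable `u`. -/
def residual (V : Space d → ℝ) (z : ℂ) (u : Space d → ℂ) (x : Space d) : ℂ :=
  z * u x - schrodinger V u x

theorem IsTest.memLp_residual {u : Space d → ℂ} (hu : IsTest u) {μ : Measure (Space d)}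
    [IsFiniteMeasureOnCompacts μ] (hV : MemLp V ∞ μ) (z : ℂ) : MemLp (residual V z u) 2 μ :=
  ((hu.memLp 2 μ).const_mul z).sub (hu.memLp_schrodinger hV)

theorem IsTest.toLp_residual {u : Space d → ℂ} (hu : IsTest u) {μ : Measure (Space d)}
    [IsFiniteMeasureOnCompacts μ] (hV : MemLp V ∞ μ) (z : ℂ) :
    (hu.memLp_residual hV z).toLp _ =
      z • (hu.memLp 2 μ).toLp u - (hu.memLp_schrodinger hV).toLp _ := rfl

theorem residual_smul {χ : Space d → ℝ} {u : Space d → ℂ}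
    (hχ : ContDiff ℝ ∞ χ) (hu : ContDiff ℝ ∞ u) (z : ℂ) (x : Space d) :
    residual V z (fun y ↦ χ y • u y) x = χ x * residual V z u x + cutoffCommutator χ u x := by
  rw [residual, schrodinger_smul hχ hu, residual, Complex.real_smul]
  ring

theorem IsTest.memLp_cutoffCommutator {u : Space d → ℂ} (hu : IsTest u) {χ : Space d → ℝ}
    (hχ : ContDiff ℝ ∞ χ) {μ : Measure (Space d)} [IsFiniteMeasureOnCompacts μ] :
    MemLp (cutoffCommutator χ u) 2 μ := by
  have h := (((hu.smul hχ).laplacian.memLp 2 μ).sub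
    ((hu.laplacian.smul hχ).memLp 2 μ)).const_mul (1 / 2 : ℂ)
  convert h using 1
  funext x
  change _ = (1 / 2 : ℂ) * (Δ (fun y ↦ χ y • u y) x - χ x • Δ u x)
  rw [laplacian_smul_eq_add_cutoffCommutator hχ hu.smooth, Complex.real_smul]
  ring

/-- The quadratic form of `-½Δ + V`. -/
theorem IsTest.inner_schrodinger {w : Space d → ℂ} (hw : IsTest w) (hV : MemLp V ∞ volume) :
    inner ℂ ((hw.memLp 2 volume).toLp w) ((hw.memLp_schrodinger hV).toLp _) =
      ((1 / 2 * (∫ x, gradSq w x) + ∫ x, V x * ‖w x‖ ^ 2 : ℝ) : ℂ) := by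
  rw [inner_toLp, integral_congr_ae (g := fun x ↦ -(1 / 2 : ℂ) * (starRingEnd ℂ (w x) * Δ w x) +
    ((V x * ‖w x‖ ^ 2 : ℝ) : ℂ))]
  · have i1 : Integrable (fun x ↦ starRingEnd ℂ (w x) * Δ w x) :=
      memLp_one_iff_integrable.mp
        ((hw.laplacian.memLp 2 volume).mul' (p := 2) (q := 2) (hw.conj.memLp 2 volume))
    have i2 : Integrable (fun x ↦ V x * ‖w x‖ ^ 2) :=
      memLp_one_iff_integrable.mp
        ((memLp_one_iff_integrable.mpr hw.integrable_norm_sq).mul' (p := ∞) (q := 1) hV)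
    have i3 : Integrable (fun x ↦ ((V x * ‖w x‖ ^ 2 : ℝ) : ℂ)) := i2.ofReal
    rw [integral_add (i1.const_mul _) i3, integral_const_mul, integral_complex_ofReal]
    push_cast
    rw [hw.integral_gradSq]
    ring
  · filter_upwards [(hw.memLp_schrodinger hV).coeFn_toLp] with x hx
    have h : (w x) * starRingEnd ℂ (w x) = (‖w x‖ ^ 2 : ℝ) := by
      rw [Complex.mul_conj, Complex.normSq_eq_norm_sq]
    rw [hx, schrodinger]
    push_cast at h ⊢
    rw [← h]
    ring

/-- The constant of the energy estimate for a potential bounded by `v` and a gap of half-width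
`a`. -/
def energyConst (εF a v : ℝ) : ℝ := (1 + 2 * (|εF| + v)) / a + 2

theorem energyConst_nonneg (εF : ℝ) {a v : ℝ} (ha : 0 < a) (hv : 0 ≤ v) :
    0 ≤ energyConst εF a v := by
  unfold energyConst
  positivity

theorem abs_le_of_eLpNorm_le {v : ℝ≥0} (hv : eLpNorm V ∞ volume ≤ v) : ∀ᵐ x, |V x| ≤ v := by
  rw [eLpNorm_exponent_top] at hv
  filter_upwards [enorm_ae_le_eLpNormEssSup V volume] with x hx
  have h := hx.trans hv
  rw [← Real.norm_eq_abs]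
  exact_mod_cast (show (‖V x‖₊ : ℝ≥0∞) ≤ v from h)

/-- The resolvent gains one derivative in `L²`, with a constant that decays along the vertical
line through the Fermi level. -/
theorem IsTest.energy_le {w : Space d → ℂ} (hw : IsTest w) (hV : MemLp V ∞ volume) {v : ℝ≥0}
    (hv : eLpNorm V ∞ volume ≤ v) {εF a : ℝ} (hA : IsGapped (hamiltonian V) εF a) (t : ℝ) :
    ∫ x, (‖w x‖ ^ 2 + gradSq w x) ≤ energyConst εF a v / √(a ^ 2 + t ^ 2) *
      ∫ x, ‖residual V (εF + t * Complex.I) w x‖ ^ 2 := by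
  have ha := hA.pos
  set z : ℂ := εF + t * Complex.I with hz
  set W := (hw.memLp 2 volume).toLp w with hW
  set T := (hw.memLp_schrodinger hV).toLp _ with hT
  have hWsq : ‖W‖ ^ 2 = ∫ x, ‖w x‖ ^ 2 := norm_toLp_sq _
  have hF : ‖z • W - T‖ ^ 2 = ∫ x, ‖residual V z w x‖ ^ 2 := by
    rw [← norm_toLp_sq (hw.memLp_residual hV z), hw.toLp_residual hV]
  rw [integral_add hw.integrable_norm_sq hw.integrable_gradSq, ← hWsq, ← hF]
  set G := ∫ x, gradSq w x
  set F := ‖z • W - T‖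
  obtain ⟨y, hyW, hyT⟩ := LinearPMap.mem_graph_iff _ |>.mp (hw.mem_graph_hamiltonian hV)
  have hlow : (a ^ 2 + t ^ 2) * ‖W‖ ^ 2 ≤ F ^ 2 := by
    have := hA.lower_bound t y
    rwa [hyW, hyT] at this
  have hpot : |∫ x, V x * ‖w x‖ ^ 2| ≤ v * ‖W‖ ^ 2 := by
    rw [hWsq, ← integral_const_mul, ← Real.norm_eq_abs]
    refine norm_integral_le_of_norm_le (hw.integrable_norm_sq.const_mul _) ?_
    filter_upwards [abs_le_of_eLpNorm_le hv] with x hx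
    rw [norm_mul, Real.norm_eq_abs, Real.norm_of_nonneg (by positivity : 0 ≤ ‖w x‖ ^ 2)]
    gcongr
  have hform : (inner ℂ W T).re = 1 / 2 * G + ∫ x, V x * ‖w x‖ ^ 2 := by
    rw [hW, hT, hw.inner_schrodinger hV, Complex.ofReal_re]
  have hWF : (inner ℂ W (z • W - T)).re = εF * ‖W‖ ^ 2 - (inner ℂ W T).re := by
    have h : inner ℂ W W = ((‖W‖ ^ 2 : ℝ) : ℂ) := by
      rw [inner_self_eq_norm_sq_to_K]
      push_cast
      rfl
    rw [inner_sub_right, inner_smul_right, h, Complex.sub_re, hz]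
    simp [-Complex.ofReal_pow]
  have hcs : -(‖W‖ * F) ≤ (inner ℂ W (z • W - T)).re := by
    have h1 := norm_inner_le_norm (𝕜 := ℂ) W (z • W - T)
    have h2 := (Complex.abs_re_le_norm (inner ℂ W (z • W - T))).trans h1
    exact (abs_le.mp h2).1
  set δ := √(a ^ 2 + t ^ 2) with hδ
  have hδsq : δ ^ 2 = a ^ 2 + t ^ 2 := Real.sq_sqrt (by positivity)
  have haδ : a ≤ δ := Real.le_sqrt_of_sq_le (by nlinarith [sq_nonneg t])
  have hδ0 : 0 < δ := ha.trans_le haδ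
  have hF0 : 0 ≤ F := norm_nonneg _
  have hN : ‖W‖ ≤ F / δ := by
    rw [le_div_iff₀ hδ0]
    refine le_of_sq_le_sq ?_ hF0
    nlinarith
  have hv0 : (0 : ℝ) ≤ v := v.2
  have hG : G ≤ 2 * (|εF| + v) * ‖W‖ ^ 2 + 2 * (‖W‖ * F) := by
    have h1 := (abs_le.mp hpot).1
    have h2 := mul_le_mul_of_nonneg_right (le_abs_self εF) (sq_nonneg ‖W‖)
    linarith
  calc ‖W‖ ^ 2 + G ≤ (1 + 2 * (|εF| + v)) * ‖W‖ ^ 2 + 2 * (‖W‖ * F) := by linarith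
    _ ≤ (1 + 2 * (|εF| + v)) * (F / δ) ^ 2 + 2 * (F / δ * F) := by gcongr
    _ = ((1 + 2 * (|εF| + v)) / δ + 2) / δ * F ^ 2 := by field_simp
    _ ≤ _ := by
        rw [energyConst]
        gcongr

end Energy

/-! ### Exponential decay -/

section Decay

variable {d : ℕ} {V : Space d → ℝ}

theorem measurableSet_lt_infDist (S : Set (Space d)) (r : ℝ) :
    MeasurableSet {x | r < Metric.infDist x S} :=
  (isOpen_lt continuous_const (Metric.continuous_infDist_pt S)).measurableSet

/-- The energy of `u` at distance more than `r` from `S`. -/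
def tailEnergy (S : Set (Space d)) (u : Space d → ℂ) (r : ℝ) : ℝ :=
  ∫ x in {x | r < Metric.infDist x S}, (‖u x‖ ^ 2 + gradSq u x)

theorem IsTest.integrable_energy {u : Space d → ℂ} (hu : IsTest u) :
    Integrable (fun x ↦ ‖u x‖ ^ 2 + gradSq u x) :=
  hu.integrable_norm_sq.add hu.integrable_gradSq

theorem energy_nonneg (u : Space d → ℂ) (x : Space d) : 0 ≤ ‖u x‖ ^ 2 + gradSq u x :=
  add_nonneg (by positivity) (gradSq_nonneg u x)

theorem IsTest.setIntegral_shell {u : Space d → ℂ} (hu : IsTest u) (S : Set (Space d)) (r : ℝ) :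
    ∫ x in {x | r < Metric.infDist x S} \ {x | r + 1 < Metric.infDist x S},
      (‖u x‖ ^ 2 + gradSq u x) = tailEnergy S u r - tailEnergy S u (r + 1) :=
  setIntegral_sdiff (measurableSet_lt_infDist S _) hu.integrable_energy.integrableOn
    fun _ hx ↦ lt_trans (lt_add_one r) hx

theorem IsTest.tailEnergy_add_one_le {u : Space d → ℂ} (hu : IsTest u) (S : Set (Space d))
    (r : ℝ) : tailEnergy S u (r + 1) ≤ tailEnergy S u r := by
  have h := hu.setIntegral_shell S r
  have := setIntegral_nonneg (μ := volume) ((measurableSet_lt_infDist S r).diff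
    (measurableSet_lt_infDist S (r + 1))) fun x _ ↦ energy_nonneg u x
  linarith

/-- The residual of `χu`: it vanishes near `S`, and the derivatives of `χ` only enter in the shell
where `χ` varies. -/
theorem IsCutoff.norm_residual_smul_sq_le {u : Space d → ℂ} (hu : ContDiff ℝ ∞ u)
    {S : Set (Space d)} {r M : ℝ} {χ : Space d → ℝ} (h : IsCutoff S r M χ) (hr : 0 ≤ r) (z : ℂ)
    (x : Space d) : ‖residual V z (fun y ↦ χ y • u y) x‖ ^ 2 ≤
      {x | 0 < Metric.infDist x S}.indicator (fun x ↦ 2 * ‖residual V z u x‖ ^ 2) x +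
      ({x | r < Metric.infDist x S} \ {x | r + 1 < Metric.infDist x S}).indicator
        (fun x ↦ 4 * M ^ 2 * (‖u x‖ ^ 2 + gradSq u x)) x := by
  have e1 : 2 * ‖χ x * residual V z u x‖ ^ 2 ≤
      {x | 0 < Metric.infDist x S}.indicator (fun x ↦ 2 * ‖residual V z u x‖ ^ 2) x := by
    by_cases hx : x ∈ {x | 0 < Metric.infDist x S}
    · rw [Set.indicator_of_mem hx, norm_mul, Complex.norm_real]
      have : ‖χ x‖ ≤ 1 := h.abs_le_one x
      gcongr
      exact mul_le_of_le_one_left (norm_nonneg _) this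
    · rw [(h.eq_zero x ((le_of_not_gt hx).trans hr)).eq_of_nhds, Set.indicator_of_notMem hx]
      simp
  have e2 : 2 * ‖cutoffCommutator χ u x‖ ^ 2 ≤
      ({x | r < Metric.infDist x S} \ {x | r + 1 < Metric.infDist x S}).indicator
        (fun x ↦ 4 * M ^ 2 * (‖u x‖ ^ 2 + gradSq u x)) x := by
    by_cases hx : x ∈ {x | r < Metric.infDist x S} \ {x | r + 1 < Metric.infDist x S}
    · rw [Set.indicator_of_mem hx]
      linarith [h.norm_cutoffCommutator_sq_le u x]
    · have h0 : cutoffCommutator χ u x = 0 := by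
        rcases le_or_gt (Metric.infDist x S) r with hle | hlt
        · exact cutoffCommutator_eq_zero (h.eq_zero x hle) u
        · have h' : r + 1 < Metric.infDist x S := by
            by_contra hcon
            exact hx ⟨hlt, hcon⟩
          exact cutoffCommutator_eq_zero (h.eq_one x h'.le) u
      rw [h0, Set.indicator_of_notMem hx]
      simp
  rw [residual_smul h.smooth hu]
  calc _ ≤ (‖χ x * residual V z u x‖ + ‖cutoffCommutator χ u x‖) ^ 2 := by
        gcongr
        exact norm_add_le _ _
    _ ≤ 2 * (‖χ x * residual V z u x‖ ^ 2 + ‖cutoffCommutator χ u x‖ ^ 2) := add_sq_le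
    _ ≤ _ := by linarith

/-- One step away from `S`: the energy is controlled by the residual outside `S` and by the energy
in a shell of width one, where the cutoff varies. -/
theorem IsTest.tailEnergy_step {u : Space d → ℂ} (hu : IsTest u) (hV : MemLp V ∞ volume) {v : ℝ≥0}
    (hv : eLpNorm V ∞ volume ≤ v) {εF a : ℝ} (hA : IsGapped (hamiltonian V) εF a) (t : ℝ)
    {S : Set (Space d)} {r M : ℝ} (hr : 0 ≤ r) {χ : Space d → ℝ} (h : IsCutoff S r M χ) :
    tailEnergy S u (r + 1) ≤ energyConst εF a v / √(a ^ 2 + t ^ 2) *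
      (2 * (∫ x in {x | 0 < Metric.infDist x S}, ‖residual V (εF + t * Complex.I) u x‖ ^ 2) +
        4 * M ^ 2 * (tailEnergy S u r - tailEnergy S u (r + 1))) := by
  set z : ℂ := εF + t * Complex.I
  have hmA : MeasurableSet {x | 0 < Metric.infDist x S} := measurableSet_lt_infDist S 0
  have hmB : MeasurableSet ({x | r < Metric.infDist x S} \ {x | r + 1 < Metric.infDist x S}) :=
    (measurableSet_lt_infDist S r).diff (measurableSet_lt_infDist S _)
  have hw := hu.smul h.smooth
  have hres : Integrable (fun x ↦ ‖residual V z u x‖ ^ 2) :=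
    (hu.memLp_residual hV z).integrable_norm_pow (by norm_num)
  have i1 := (hres.const_mul 2).indicator hmA
  have i2 := (hu.integrable_energy.const_mul (4 * M ^ 2)).indicator hmB
  have hR : ∫ x, ‖residual V z (fun y ↦ χ y • u y) x‖ ^ 2 ≤
      2 * (∫ x in {x | 0 < Metric.infDist x S}, ‖residual V z u x‖ ^ 2) +
        4 * M ^ 2 * (tailEnergy S u r - tailEnergy S u (r + 1)) := by
    rw [← hu.setIntegral_shell S r, ← integral_const_mul, ← integral_const_mul,
      ← integral_indicator hmA, ← integral_indicator hmB, ← integral_add i1 i2]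
    exact integral_mono ((hw.memLp_residual hV z).integrable_norm_pow (by norm_num))
      (i1.add i2) fun x ↦ h.norm_residual_smul_sq_le hu.smooth hr z x
  have hL : tailEnergy S u (r + 1) ≤ ∫ x, (‖χ x • u x‖ ^ 2 + gradSq (fun y ↦ χ y • u y) x) := by
    have e : tailEnergy S u (r + 1) = ∫ x in {x | r + 1 < Metric.infDist x S},
          (‖χ x • u x‖ ^ 2 + gradSq (fun y ↦ χ y • u y) x) := by
      refine setIntegral_congr_fun (measurableSet_lt_infDist S _) fun x hx ↦ ?_
      have h1 := h.eq_one x (le_of_lt hx)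
      have hw : (fun y ↦ χ y • u y) =ᶠ[nhds x] u := by
        filter_upwards [h1] with y hy
        rw [hy, one_smul]
      simp only [gradSq, hw.fderiv_eq, h1.eq_of_nhds, one_smul]
    rw [e]
    exact setIntegral_le_integral hw.integrable_energy
      (Filter.Eventually.of_forall (energy_nonneg fun y ↦ χ y • u y))
  refine (hL.trans (hw.energy_le hV hv hA t)).trans (mul_le_mul_of_nonneg_left hR ?_)
  exact div_nonneg (energyConst_nonneg εF hA.pos v.2) (Real.sqrt_nonneg _)

/-- A sequence whose value is at most `A` plus a multiple of its last decrement decays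
geometrically down to `A`. -/
theorem le_pow_mul_add {E : ℕ → ℝ} {A K : ℝ} (hK : 0 ≤ K)
    (h : ∀ n, E (n + 1) ≤ A + K * (E n - E (n + 1))) (hA : 0 ≤ A) (n : ℕ) :
    E n ≤ (K / (1 + K)) ^ n * E 0 + A := by
  have hK1 : 0 < 1 + K := by linarith
  induction n with
  | zero => simpa using hA
  | succ n ih =>
    have h1 : E (n + 1) ≤ (A + K * E n) / (1 + K) := by
      rw [le_div_iff₀ hK1]
      linarith [h n]
    calc E (n + 1) ≤ (A + K * E n) / (1 + K) := h1
      _ ≤ (A + K * ((K / (1 + K)) ^ n * E 0 + A)) / (1 + K) := by gcongr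
      _ = K / (1 + K) * (K / (1 + K)) ^ n * E 0 + A := by
          generalize (K / (1 + K)) ^ n = q
          field_simp
          ring
      _ = _ := by rw [pow_succ']

/-- Exponential decay of approximate solutions of `(z - H)u = 0` away from `S`, uniformly in `z`
on the vertical line through the Fermi level, with an additional factor `(a² + t²)^(-1/2)` from
the last step. -/
theorem IsTest.tailEnergy_le {u : Space d → ℂ} (hu : IsTest u) (hV : MemLp V ∞ volume) {v : ℝ≥0}
    (hv : eLpNorm V ∞ volume ≤ v) {εF a : ℝ} (hA : IsGapped (hamiltonian V) εF a) (t : ℝ)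
    {S : Set (Space d)} {M : ℝ} (hM : ∀ r : ℝ, ∃ χ : Space d → ℝ, IsCutoff S r M χ)
    {κ : ℝ} (hκ : κ = energyConst εF a v / √(a ^ 2 + t ^ 2))
    {K : ℝ} (hK : 4 * M ^ 2 * energyConst εF a v / a = K)
    {A : ℝ} (hAb : A = κ * (2 *
      ∫ x in {x | 0 < Metric.infDist x S}, ‖residual V (εF + t * Complex.I) u x‖ ^ 2)) (n : ℕ) :
    tailEnergy S u (n + 1) ≤ A + 4 * M ^ 2 * κ * ((K / (1 + K)) ^ n *
      (κ * ∫ x, ‖residual V (εF + t * Complex.I) u x‖ ^ 2) + A) := by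
  have ha := hA.pos
  have hc0 := energyConst_nonneg εF ha v.2
  have hκ0 : 0 ≤ κ := by rw [hκ]; positivity
  have hδ : a ≤ √(a ^ 2 + t ^ 2) := Real.le_sqrt_of_sq_le (by nlinarith [sq_nonneg t])
  have hK0 : 0 ≤ K := by rw [← hK]; positivity
  have hκK : 4 * M ^ 2 * κ ≤ K := by
    rw [← hK, hκ, mul_div_assoc]
    gcongr
  have hA0 : 0 ≤ A := by
    rw [hAb]
    exact mul_nonneg hκ0 (mul_nonneg zero_le_two (integral_nonneg fun x ↦ sq_nonneg _))
  have hstep : ∀ n : ℕ, tailEnergy S u (n + 1) ≤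
      A + 4 * M ^ 2 * κ * (tailEnergy S u n - tailEnergy S u (n + 1)) := by
    intro n
    obtain ⟨χ, hχ⟩ := hM n
    have := hu.tailEnergy_step hV hv hA t n.cast_nonneg hχ
    rw [← hκ] at this
    rw [hAb]
    linarith
  have hgeo := le_pow_mul_add (E := fun n : ℕ ↦ tailEnergy S u n) hK0 (fun n ↦ by
    push_cast
    refine (hstep n).trans ?_
    have := hu.tailEnergy_add_one_le S n
    gcongr) hA0 n
  have hE0 : tailEnergy S u 0 ≤ κ * ∫ x, ‖residual V (εF + t * Complex.I) u x‖ ^ 2 := by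
    rw [hκ]
    exact (setIntegral_le_integral hu.integrable_energy
      (Filter.Eventually.of_forall fun x ↦ energy_nonneg u x)).trans (hu.energy_le hV hv hA t)
  have hE1 : 0 ≤ tailEnergy S u (n + 1) := integral_nonneg fun x ↦ energy_nonneg u x
  calc tailEnergy S u (n + 1)
      ≤ A + 4 * M ^ 2 * κ * (tailEnergy S u n - tailEnergy S u (n + 1)) := hstep n
    _ ≤ A + 4 * M ^ 2 * κ * tailEnergy S u n := by gcongr; linarith
    _ ≤ A + 4 * M ^ 2 * κ * ((K / (1 + K)) ^ n * tailEnergy S u 0 + A) := by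
        gcongr
        simpa using hgeo
    _ ≤ _ := by gcongr

end Decay

/-! ### Comparison of the resolvents of the system and of the subsystem -/

section Comparison

variable {d : ℕ} {V : Space d → ℝ}

theorem restrictTo_toLp {f : Space d → ℂ} (hf : MemLp f 2 volume) (U : Set (Space d)) :
    restrictTo U (hf.toLp f) = (hf.restrict U).toLp f := by
  refine Lp.ext ?_
  filter_upwards [LpToLpRestrictCLM_coeFn (𝕜 := ℂ) U (hf.toLp f), (hf.restrict U).coeFn_toLp,
    ae_restrict_of_ae hf.coeFn_toLp] with x h1 h2 h3
  rw [h2, ← h3, ← h1]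
  rfl

theorem norm_restrictTo_le (U : Set (Space d)) (f : Lp ℂ 2 (volume : Measure (Space d))) :
    ‖restrictTo U f‖ ≤ ‖f‖ := norm_Lp_toLp_restrict_le U f

theorem norm_restrictTo_of_support_subset {f : Space d → ℂ} (hf : MemLp f 2 volume)
    {U : Set (Space d)} (hU : Function.support f ⊆ U) :
    ‖restrictTo U (hf.toLp f)‖ = ‖hf.toLp f‖ := by
  rw [← sq_eq_sq₀ (norm_nonneg _) (norm_nonneg _), restrictTo_toLp, norm_toLp_sq, norm_toLp_sq]
  refine setIntegral_eq_integral_of_forall_compl_eq_zero fun x hx ↦ ?_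
  rw [Function.notMem_support.mp fun h ↦ hx (hU h)]
  simp

theorem IsGapped.norm_resolvent_line_le {𝓗 : Type*} [NormedAddCommGroup 𝓗] [InnerProductSpace ℂ 𝓗]
    [CompleteSpace 𝓗] {A : 𝓗 →ₗ.[ℂ] 𝓗} {εF a : ℝ} (hA : IsGapped A εF a) (t : ℝ) (f : 𝓗) :
    ‖resolvent A (εF + t * Complex.I) f‖ ≤ ‖f‖ / √(a ^ 2 + t ^ 2) := by
  have hpos : 0 < a ^ 2 + t ^ 2 := by have := hA.pos; positivity
  rw [le_div_iff₀ (Real.sqrt_pos.mpr hpos)]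
  refine le_of_sq_le_sq ?_ (norm_nonneg f)
  rw [mul_pow, Real.sq_sqrt hpos.le, mul_comm]
  exact hA.norm_resolvent_line_sq_le t f

theorem IsCutoff.tsupport_one_sub_smul_subset {S : Set (Space d)} {r M : ℝ} {χ : Space d → ℝ}
    (h : IsCutoff S r M χ) (u : Space d → ℂ) :
    tsupport (fun y ↦ (1 - χ y) • u y) ⊆ {x | Metric.infDist x S ≤ r + 1} := by
  refine closure_minimal (fun x hx ↦ ?_)
    (isClosed_le (Metric.continuous_infDist_pt S) continuous_const)
  by_contra hcon
  refine hx ?_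
  simp [(h.eq_one x (le_of_not_ge hcon)).eq_of_nhds]

theorem IsCutoff.integral_norm_cutoffCommutator_sq_le {S : Set (Space d)} {r M : ℝ}
    {χ : Space d → ℝ} (h : IsCutoff S r M χ) {u : Space d → ℂ} (hu : IsTest u) :
    ∫ x, ‖cutoffCommutator χ u x‖ ^ 2 ≤ 2 * M ^ 2 * tailEnergy S u r := by
  rw [tailEnergy, ← integral_const_mul, ← integral_indicator (measurableSet_lt_infDist S r)]
  refine integral_mono ((hu.memLp_cutoffCommutator h.smooth).integrable_norm_pow (by norm_num))
    ((hu.integrable_energy.const_mul _).indicator (measurableSet_lt_infDist S r)) fun x ↦ ?_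
  by_cases hx : x ∈ {x | r < Metric.infDist x S}
  · rw [Set.indicator_of_mem hx]
    exact h.norm_cutoffCommutator_sq_le u x
  · rw [Set.indicator_of_notMem hx, cutoffCommutator_eq_zero (h.eq_zero x (le_of_not_gt hx))]
    simp

/-- The residual in `U` of a cut off approximation of `(z - H)⁻¹f`. -/
theorem IsCutoff.norm_residual_sub_le {f : Space d → ℂ} (hf : MemLp f 2 volume) {r M : ℝ}
    (hr : 0 ≤ r) {χ : Space d → ℝ} (h : IsCutoff (Function.support f) r M χ) {u : Space d → ℂ}
    (hu : IsTest u) (hV : MemLp V ∞ volume) (U : Set (Space d)) (z : ℂ) :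
    ‖((hu.smul (contDiff_one_sub h.smooth)).memLp_residual (hV.restrict U) z).toLp _ -
        restrictTo U (hf.toLp f)‖ ≤
      2 * ‖(hu.memLp_residual hV z).toLp _ - hf.toLp f‖ +
        √(2 * M ^ 2 * tailEnergy (Function.support f) u r) := by
  have hη := contDiff_one_sub h.smooth
  have hm := (hu.memLp_residual hV z).sub hf
  have hc : MemLp (cutoffCommutator χ u) 2 volume := hu.memLp_cutoffCommutator h.smooth
  -- `1 - χ = 1` on the support of `f`
  have hfχ : ∀ x, χ x * f x = 0 := fun x ↦ by
    by_cases hx : x ∈ Function.support f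
    · have := (h.eq_zero x (by rw [Metric.infDist_zero_of_mem hx]; exact hr)).eq_of_nhds
      simp [this]
    · simp [Function.notMem_support.mp hx]
  have e : ∀ x, residual V z (fun y ↦ (1 - χ y) • u y) x - f x + cutoffCommutator χ u x =
      ((1 - χ x : ℝ) : ℂ) * (residual V z u x - f x) := fun x ↦ by
    rw [residual_smul hη hu.smooth, cutoffCommutator_one_sub h.smooth]
    push_cast
    linear_combination -hfχ x
  have hm1 : MemLp (fun x ↦ ((1 - χ x : ℝ) : ℂ) * (residual V z u x - f x)) 2 volume := by
    have := (((hu.smul hη).memLp_residual hV z).sub hf).add hc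
    refine this.congr_norm ?_ (Filter.Eventually.of_forall fun x ↦ ?_)
    · exact this.1.congr (Filter.Eventually.of_forall fun x ↦ e x)
    · exact congrArg _ (e x)
  have hsplit : ((hu.smul hη).memLp_residual (hV.restrict U) z).toLp _ - restrictTo U (hf.toLp f) =
      restrictTo U (hm1.toLp _) - restrictTo U (hc.toLp _) := by
    rw [restrictTo_toLp, restrictTo_toLp, restrictTo_toLp, ← MemLp.toLp_sub, ← MemLp.toLp_sub]
    refine MemLp.toLp_congr _ _ (Filter.Eventually.of_forall fun x ↦ ?_)
    exact eq_sub_of_add_eq (e x)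
  rw [hsplit]
  refine (norm_sub_le _ _).trans (add_le_add ((norm_restrictTo_le U _).trans ?_)
    ((norm_restrictTo_le U _).trans ?_))
  · rw [← MemLp.toLp_sub]
    refine le_of_sq_le_sq ?_ (by positivity)
    rw [mul_pow, norm_toLp_sq, norm_toLp_sq, ← integral_const_mul]
    refine integral_mono (hm1.integrable_norm_pow (by norm_num))
      ((hm.integrable_norm_pow (by norm_num)).const_mul _) fun x ↦ ?_
    have h2 : ‖((1 - χ x : ℝ) : ℂ)‖ ≤ 2 := by
      rw [Complex.norm_real, Real.norm_eq_abs]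
      have := abs_le.mp (h.abs_le_one x)
      exact abs_le.mpr ⟨by linarith, by linarith⟩
    simp only [norm_mul, mul_pow, Pi.sub_apply]
    gcongr
  · refine Real.le_sqrt_of_sq_le ?_
    rw [norm_toLp_sq]
    exact h.integral_norm_cutoffCommutator_sq_le hu

/-- Cutting off an approximation of `(z - H)⁻¹f` gives an approximation of `(z - B)⁻¹f` for every
restriction `B`, whatever its boundary conditions. -/
theorem IsRestriction.norm_inner_sub_le {U : Set (Space d)} (hU : IsOpen U)
    {B : Lp ℂ 2 (volume.restrict U) →ₗ.[ℂ] Lp ℂ 2 (volume.restrict U)} (hB : IsRestriction V U B)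
    {εF a : ℝ} (hgap : IsGapped B εF a) (hV : MemLp V ∞ volume) {f : Space d → ℂ}
    (hf : MemLp f 2 volume) {r M : ℝ} (hr : 0 ≤ r) {χ : Space d → ℝ}
    (h : IsCutoff (Function.support f) r M χ)
    (hfU : {x | Metric.infDist x (Function.support f) ≤ r + 1} ⊆ U) {u : Space d → ℂ}
    (hu : IsTest u) (t : ℝ) :
    ‖inner ℂ (hf.toLp f) ((hu.memLp 2 volume).toLp u) - inner ℂ (restrictTo U (hf.toLp f))
        (resolvent B (εF + t * Complex.I) (restrictTo U (hf.toLp f)))‖ ≤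
      ‖hf.toLp f‖ / √(a ^ 2 + t ^ 2) *
        (2 * ‖(hu.memLp_residual hV (εF + t * Complex.I)).toLp _ - hf.toLp f‖ +
          √(2 * M ^ 2 * tailEnergy (Function.support f) u r)) := by
  set z : ℂ := εF + t * Complex.I with hz
  have hψ := hu.smul (contDiff_one_sub h.smooth)
  have hsupp := (h.tsupport_one_sub_smul_subset u).trans hfU
  obtain ⟨y, hy, hBy⟩ := LinearPMap.mem_graph_iff _ |>.mp
    (hB.mem_graph hU (hV.restrict U) hψ hsupp)
  have hR := (isResolventAt_resolvent (hgap.line_mem_resolventSet t)).left_inv y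
  rw [hy, hBy, ← hz] at hR
  change resolvent B z ((hψ.memLp_residual (hV.restrict U) z).toLp _) =
    (hψ.memLp 2 (volume.restrict U)).toLp _ at hR
  have hin : inner ℂ (hf.toLp f) ((hu.memLp 2 volume).toLp u) =
      inner ℂ (restrictTo U (hf.toLp f)) ((hψ.memLp 2 (volume.restrict U)).toLp _) := by
    rw [restrictTo_toLp, inner_toLp, inner_toLp]
    have e1 : ∫ x in U, starRingEnd ℂ (f x) *
        ((hψ.memLp 2 (volume.restrict U)).toLp _ : Lp ℂ 2 (volume.restrict U)) x =
        ∫ x in U, starRingEnd ℂ (f x) * u x := by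
      refine integral_congr_ae ?_
      filter_upwards [(hψ.memLp 2 (volume.restrict U)).coeFn_toLp] with x hx
      rw [hx]
      by_cases hfx : x ∈ Function.support f
      · have := (h.eq_zero x (by rw [Metric.infDist_zero_of_mem hfx]; exact hr)).eq_of_nhds
        simp [this]
      · simp [Function.notMem_support.mp hfx]
    rw [e1, setIntegral_eq_integral_of_forall_compl_eq_zero]
    · refine integral_congr_ae ?_
      filter_upwards [(hu.memLp 2 volume).coeFn_toLp] with x hx
      rw [hx]
    · intro x hx
      have hfx : f x = 0 := by
        by_contra hne
        refine hx (hfU ?_)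
        change Metric.infDist x (Function.support f) ≤ r + 1
        rw [Metric.infDist_zero_of_mem hne]
        positivity
      simp [hfx]
  rw [hin, ← hR, ← inner_sub_right, ← map_sub]
  refine (norm_inner_le_norm _ _).trans ?_
  calc _ ≤ ‖hf.toLp f‖ * (‖((hψ.memLp_residual (hV.restrict U) z).toLp _) -
        restrictTo U (hf.toLp f)‖ / √(a ^ 2 + t ^ 2)) := by
        gcongr
        · exact norm_restrictTo_le U _
        · exact hgap.norm_resolvent_line_le t _
    _ = ‖hf.toLp f‖ / √(a ^ 2 + t ^ 2) * ‖((hψ.memLp_residual (hV.restrict U) z).toLp _) -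
        restrictTo U (hf.toLp f)‖ := by ring
    _ ≤ _ := by
        gcongr
        exact h.norm_residual_sub_le hf hr hu hV U z

/-- The diagonal resolvent matrix elements of the system and of the subsystem differ by an
exponentially small amount, with a decay along the vertical line that makes the difference
integrable. -/
theorem IsRestriction.norm_inner_resolvent_sub_le {U : Set (Space d)} (hU : IsOpen U)
    {B : Lp ℂ 2 (volume.restrict U) →ₗ.[ℂ] Lp ℂ 2 (volume.restrict U)} (hB : IsRestriction V U B)
    {εF a : ℝ} (hgap : IsGapped B εF a) (hA : IsGapped (hamiltonian V) εF a)
    (hV : MemLp V ∞ volume) {v : ℝ≥0} (hv : eLpNorm V ∞ volume ≤ v) {f : Space d → ℂ}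
    (hf : MemLp f 2 volume) {M : ℝ}
    (hM : ∀ r : ℝ, ∃ χ : Space d → ℝ, IsCutoff (Function.support f) r M χ) {n : ℕ}
    (hfU : {x | Metric.infDist x (Function.support f) ≤ n + 2} ⊆ U) {K θ : ℝ}
    (hK : 4 * M ^ 2 * energyConst εF a v / a = K) (hθ : θ = √(K / (1 + K))) (t : ℝ) :
    ‖inner ℂ (hf.toLp f) (resolvent (hamiltonian V) (εF + t * Complex.I) (hf.toLp f)) -
        inner ℂ (restrictTo U (hf.toLp f))
          (resolvent B (εF + t * Complex.I) (restrictTo U (hf.toLp f)))‖ ≤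
      3 * M ^ 2 * energyConst εF a v * θ ^ n * ‖hf.toLp f‖ ^ 2 * (a ^ 2 + t ^ 2)⁻¹ := by
  have ha := hA.pos
  have he := energyConst_nonneg εF ha v.2
  have hK0 : 0 ≤ K := by rw [← hK]; positivity
  set z : ℂ := εF + t * Complex.I with hz
  set Φ := hf.toLp f with hΦ
  set δ := √(a ^ 2 + t ^ 2) with hδ
  have hδ0 : 0 < δ := Real.sqrt_pos.mpr (by positivity)
  set κ := energyConst εF a v / δ with hκ
  set S := Function.support f with hS
  have hκ0 : 0 ≤ κ := by positivity
  obtain ⟨y, hy, hyΦ⟩ := (isResolventAt_resolvent (hA.line_mem_resolventSet t)).right_inv Φ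
  rw [← hz] at hy hyΦ
  choose u hu h1 h2 using fun j : ℕ ↦ exists_isTest_near hV ((hamiltonian V).mem_graph y)
    (ε := 1 / ((j : ℝ) + 1)) (by positivity)
  have t1 : Filter.Tendsto (fun j ↦ ((hu j).memLp 2 volume).toLp (u j)) Filter.atTop
      (nhds (y : Lp ℂ 2 volume)) := tendsto_iff_norm_sub_tendsto_zero.mpr
    (squeeze_zero (fun _ ↦ norm_nonneg _) (fun j ↦ (h1 j).le)
      tendsto_one_div_add_atTop_nhds_zero_nat)
  have t2 : Filter.Tendsto (fun j ↦ ((hu j).memLp_schrodinger hV).toLp _) Filter.atTop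
      (nhds (hamiltonian V y)) := tendsto_iff_norm_sub_tendsto_zero.mpr
    (squeeze_zero (fun _ ↦ norm_nonneg _) (fun j ↦ (h2 j).le)
      tendsto_one_div_add_atTop_nhds_zero_nat)
  have t3 : Filter.Tendsto (fun j ↦ ((hu j).memLp_residual hV z).toLp _) Filter.atTop
      (nhds Φ) := by
    rw [← hyΦ]
    exact (t1.const_smul z).sub t2
  have t4 := tendsto_iff_norm_sub_tendsto_zero.mp t3
  obtain ⟨χ, hχ⟩ := hM (n + 1)
  have hfU' : {x | Metric.infDist x S ≤ (n : ℝ) + 1 + 1} ⊆ U := fun x hx ↦ hfU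
    (show Metric.infDist x S ≤ n + 2 from (show Metric.infDist x S ≤ (n : ℝ) + 1 + 1 from hx).trans
      (by linarith))
  let g : ℝ × ℝ → ℝ := fun p ↦ ‖Φ‖ / δ * (2 * p.1 + √(2 * M ^ 2 * (κ * (2 * p.1 ^ 2) +
    4 * M ^ 2 * κ * ((K / (1 + K)) ^ n * (κ * p.2 ^ 2) + κ * (2 * p.1 ^ 2)))))
  have hg : Continuous g := by fun_prop
  have hbound : ∀ j, ‖inner ℂ Φ (((hu j).memLp 2 volume).toLp (u j)) -
      inner ℂ (restrictTo U Φ) (resolvent B z (restrictTo U Φ))‖ ≤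
      g (‖((hu j).memLp_residual hV z).toLp _ - Φ‖, ‖((hu j).memLp_residual hV z).toLp _‖) := by
    intro j
    refine (hB.norm_inner_sub_le hU hgap hV hf (by positivity) hχ hfU' (hu j) t).trans ?_
    -- `f` vanishes away from `S`, so the residual there is part of the error
    have hb : ∫ x in {x | 0 < Metric.infDist x S}, ‖residual V z (u j) x‖ ^ 2 ≤
        ‖((hu j).memLp_residual hV z).toLp _ - Φ‖ ^ 2 := by
      rw [hΦ, ← MemLp.toLp_sub, norm_toLp_sq]
      refine le_trans (le_of_eq ?_) (setIntegral_le_integral (s := {x | 0 < Metric.infDist x S})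
        ((((hu j).memLp_residual hV z).sub hf).integrable_norm_pow (by norm_num))
        (Filter.Eventually.of_forall fun x ↦ sq_nonneg _))
      refine setIntegral_congr_fun (measurableSet_lt_infDist S 0) fun x hx ↦ ?_
      have hfx : f x = 0 := by
        by_contra hne
        exact absurd (Metric.infDist_zero_of_mem (s := S) hne) (ne_of_gt hx)
      simp [hfx]
    have htail := (hu j).tailEnergy_le hV hv hA t hM hκ hK rfl n
    rw [← hz, ← norm_toLp_sq ((hu j).memLp_residual hV z)] at htail
    have htail' := htail.trans (show _ ≤ κ * (2 * ‖((hu j).memLp_residual hV z).toLp _ - Φ‖ ^ 2) +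
      4 * M ^ 2 * κ * ((K / (1 + K)) ^ n * (κ * ‖((hu j).memLp_residual hV z).toLp _‖ ^ 2) +
        κ * (2 * ‖((hu j).memLp_residual hV z).toLp _ - Φ‖ ^ 2)) by gcongr)
    simp only [g]
    gcongr
  have hlim := le_of_tendsto_of_tendsto
    ((((tendsto_const_nhds (x := Φ)).inner t1).sub tendsto_const_nhds).norm)
    ((hg.tendsto (0, ‖Φ‖)).comp (t4.prodMk_nhds t3.norm)) (Filter.Eventually.of_forall hbound)
  rw [← hy]
  refine hlim.trans ?_
  have hθ2 : K / (1 + K) = θ ^ 2 := by rw [hθ, Real.sq_sqrt (by positivity)]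
  have hθ0 : 0 ≤ θ := by rw [hθ]; positivity
  have hδsq : a ^ 2 + t ^ 2 = δ ^ 2 := (Real.sq_sqrt (by positivity)).symm
  calc g (0, ‖Φ‖) = ‖Φ‖ / δ * √(8 * (M ^ 2 * κ * θ ^ n * ‖Φ‖) ^ 2) := by
        simp only [g, hθ2]
        congr 2
        ring_nf
    _ ≤ ‖Φ‖ / δ * (3 * (M ^ 2 * κ * θ ^ n * ‖Φ‖)) := by
        gcongr
        refine Real.sqrt_le_iff.mpr ⟨by positivity, ?_⟩
        nlinarith [sq_nonneg (M ^ 2 * κ * θ ^ n * ‖Φ‖)]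
    _ = _ := by
        rw [hδsq, hκ]
        field_simp

end Comparison

/-! ### Distances between sets -/

section Distance

theorem infDist_le_subset_of_le_setDist {X : Type*} [PseudoMetricSpace X] {S U : Set X}
    (hS : S.Nonempty) {D r : ℝ} (hD : ENNReal.ofReal D ≤ setDist S Uᶜ) (hr : r < D) :
    {x | Metric.infDist x S ≤ r} ⊆ U := by
  intro x hx
  by_contra hxU
  have hx' : Metric.infDist x S < D := lt_of_le_of_lt hx hr
  obtain ⟨y, hy, hxy⟩ := (Metric.infDist_lt_iff hS).mp hx'
  have h1 : setDist S Uᶜ ≤ edist y x := iInf₂_le_of_le y hy (iInf₂_le x hxU)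
  have h2 := hD.trans h1
  rw [edist_comm, edist_dist, ENNReal.ofReal_le_ofReal_iff dist_nonneg] at h2
  linarith

end Distance

end DivideAndConquer

end

open DivideAndConquer in
theorem theorem1 (d : ℕ) (εF eg : ℝ) (heg : 0 < eg) (v : ℝ≥0) :
    ∃ C γ : ℝ, 0 < C ∧ 0 < γ ∧
      ∀ V : Space d → ℝ, MemLp V ∞ volume → eLpNorm V ∞ volume ≤ v →
      ∀ Λ Λb : Set (Space d), IsOpen Λb → Λ ⊆ Λb →
      ∀ HΛb : Lp ℂ 2 (volume.restrict Λb) →ₗ.[ℂ] Lp ℂ 2 (volume.restrict Λb),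
        IsRestriction V Λb HΛb →
        GapAssumption (hamiltonian V) HΛb εF eg →
      ∀ c : ℝ → ℂ, IsContour c →
        Separates c (hamiltonian V) εF → Separates c HΛb εF →
      ∀ (φ : Space d → Space d → ℂ) (hφ : ∀ x, MemLp (φ x) 2 volume),
      ∀ x ∈ Λ, ∀ D : ℝ, ENNReal.ofReal D ≤ setDist (Function.support (φ x)) Λbᶜ →
        ‖mollifiedDensity (hamiltonian V) c ((hφ x).toLp (φ x)) -
            mollifiedDensity HΛb c (restrictTo Λb ((hφ x).toLp (φ x)))‖ ≤
          C * ‖(hφ x).toLp (φ x)‖ ^ 2 * Real.exp (-2 * γ * (D - 1)) := by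
  obtain ⟨M, hM1, hM⟩ := exists_cutoff d
  have ha : 0 < eg / 2 := by positivity
  set a := eg / 2
  have he : 0 < energyConst εF a v := by
    have := v.2
    unfold energyConst
    positivity
  set K := 4 * M ^ 2 * energyConst εF a v / a with hK
  have hK0 : 0 < K := by positivity
  set θ := √(K / (1 + K)) with hθ
  have hθ0 : 0 < θ := Real.sqrt_pos.mpr (by positivity)
  have hθ1 : θ < 1 := by
    rw [hθ, Real.sqrt_lt' one_pos, one_pow, div_lt_one (by positivity)]
    linarith
  set γ := -Real.log θ / 2 with hγ
  have hγ0 : 0 < γ := by have := Real.log_neg hθ0 hθ1; rw [hγ]; linarith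
  have hθexp : θ = Real.exp (-2 * γ) := by
    rw [hγ, show -2 * (-Real.log θ / 2) = Real.log θ by ring, Real.exp_log hθ0]
  set C₀ := 3 * M ^ 2 * energyConst εF a v / a with hC₀
  have hC₀0 : 0 < C₀ := by positivity
  refine ⟨(2 + C₀) * Real.exp (4 * γ), γ, by positivity, hγ0, ?_⟩
  intro V hV hv Λ Λb hΛb _ B hB hgap c hc hcA hcB φ hφ x _ D hD
  have hA := hgap.isGapped_hamiltonian heg hV
  have hB' := hgap.isGapped_restriction heg hB
  set Φ := (hφ x).toLp (φ x) with hΦ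
  have htriv : ‖mollifiedDensity (hamiltonian V) c Φ - mollifiedDensity B c (restrictTo Λb Φ)‖ ≤
      2 * ‖Φ‖ ^ 2 := by
    have h1 := hA.norm_mollifiedDensity_le hc hcA Φ
    have h2 := hB'.norm_mollifiedDensity_le hc hcB (restrictTo Λb Φ)
    have h3 : ‖restrictTo Λb Φ‖ ^ 2 ≤ ‖Φ‖ ^ 2 := by gcongr; exact norm_restrictTo_le Λb Φ
    linarith [norm_sub_le (mollifiedDensity (hamiltonian V) c Φ)
      (mollifiedDensity B c (restrictTo Λb Φ))]
  rcases le_or_gt D 3 with hD3 | hD3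
  · -- within a bounded distance both densities are bounded
    refine htriv.trans ?_
    have h1 : 1 ≤ Real.exp (4 * γ) * Real.exp (-2 * γ * (D - 1)) := by
      rw [← Real.exp_add]
      exact Real.one_le_exp (by nlinarith)
    calc 2 * ‖Φ‖ ^ 2 ≤ (2 + C₀) * ‖Φ‖ ^ 2 * 1 := by nlinarith [sq_nonneg ‖Φ‖]
      _ ≤ (2 + C₀) * ‖Φ‖ ^ 2 * (Real.exp (4 * γ) * Real.exp (-2 * γ * (D - 1))) := by gcongr
      _ = _ := by ring
  · rcases (Function.support (φ x)).eq_empty_or_nonempty with hS | hS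
    · have h0 : Φ = 0 := by
        rw [Lp.eq_zero_iff_ae_eq_zero]
        exact (hφ x).coeFn_toLp.trans (by rw [Function.support_eq_empty_iff.mp hS])
      refine htriv.trans ?_
      simp [h0]
    · -- the largest number of shells that fit between the support and the complement of `Λb`
      set n := ⌈D⌉₊ - 3 with hn
      have h3 : 3 < ⌈D⌉₊ := Nat.lt_ceil.mpr (by exact_mod_cast hD3)
      have hnc : (n : ℝ) = ⌈D⌉₊ - 3 := by rw [hn, Nat.cast_sub h3.le]; norm_num
      have hnD : (n : ℝ) + 2 < D := by
        have := Nat.ceil_lt_add_one (by linarith : 0 ≤ D)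
        linarith
      have hDn : D - 3 ≤ n := by
        have := Nat.le_ceil D
        linarith
      have hsub := infDist_le_subset_of_le_setDist hS hD hnD
      have hsupp : Function.support (φ x) ⊆ Λb := fun y hy ↦ hsub (by
        change Metric.infDist y _ ≤ _
        rw [Metric.infDist_zero_of_mem hy]
        positivity)
      have hbound := norm_mollifiedDensity_sub_le hA hB' hc hcA hcB
        (norm_restrictTo_of_support_subset (hφ x) hsupp).symm
        (K := 3 * M ^ 2 * energyConst εF a v * θ ^ n * ‖Φ‖ ^ 2) (by positivity) fun t ↦
        hB.norm_inner_resolvent_sub_le hΛb hB' hA hV hv (hφ x) (hM _) hsub hK.symm hθ t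
      have hpow : θ ^ n ≤ Real.exp (4 * γ) * Real.exp (-2 * γ * (D - 1)) := by
        rw [hθexp, ← Real.exp_nat_mul, ← Real.exp_add]
        exact Real.exp_le_exp.mpr (by nlinarith)
      calc _ ≤ _ := hbound
        _ = C₀ * ‖Φ‖ ^ 2 * θ ^ n := by rw [hC₀]; ring
        _ ≤ (2 + C₀) * ‖Φ‖ ^ 2 * (Real.exp (4 * γ) * Real.exp (-2 * γ * (D - 1))) := by
            gcongr
            linarith
        _ = _ := by ring
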